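/- \textbf{Theorem (Consistency and joint asymptotic normality).} Let $\phi_1>0$ and $0<\phi_2<1$, and let $X=\{X(x)\}_{x\in\mathbb R^2}$ be a Gaussian intrinsic random function of order $0$ with power-law generalized covariance $K(h)=\phi_1\Gamma(-\phi_2)\|h\|^{2\phi_2}$; that is, for all points $x_1,\dots,x_k\in\mathbb R^2$ and real $c_1,\dots,c_k$ with $\sum_i c_i=0$, the variable $\sum_i c_iX(x_i)$ is Gaussian with mean $0$ and variance $\sum_{i,j}c_ic_jK(x_i-x_j)$. Write $X_t=X(t)$ for $t\in\mathbb Z^2$, $\Lambda_k=\{0,\dots,k-1\}^2$, $e_1=(1,0)$, $e_2=(0,1)$, and suppose that $X$ is observed on $\Lambda_n$; put $N=n^2$. For $r\in\{1,2\}$ let $$D_{[r]}X_t=X_t-X_{t+re_1}-X_{t+re_2}+X_{t+re_1+re_2},\qquad Q_r=Q_{r,n}=\frac1{|\Lambda_{n-2r}|}\sum_{t\in\Lambda_{n-2r}}(D_{[r]}X_t)^2\quad(n>2r),$$ let $a_1(\phi)=|\Gamma(-\phi)|\,(8-4\cdot2^{\phi})$, and define the estimators $$\widehat\phi_2=\tfrac12\log_2\!\left(Q_2/Q_1\right),\qquad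 \widehat\phi_1=Q_1/a_1(\widehat\phi_2).$$ Define also $$f_0(\lambda)=\pi\,2^{2+2\phi_2}\,\Gamma(1+\phi_2)\,\phi_1\,\|\lambda\|^{-(2+2\phi_2)},\qquad f_X(\lambda)=\sum_{m\in\mathbb Z^2}f_0(\lambda+2\pi m),\qquad f(\lambda)=\bigl|(1-e^{i\lambda_1})(1-e^{i\lambda_2})\bigr|^2f_X(\lambda)$$ on $\mathbb T^2=(-\pi,\pi]^2$ with $\mu(\mathrm d\lambda)=(2\pi)^{-2}\mathrm d\lambda$, let $b_1\equiv1$ and $b_2(\lambda)=16\cos^2(\lambda_1/2)\cos^2(\lambda_2/2)$, and $$\Sigma_{jk}=2\int_{\mathbb T^2}b_j(\lambda)\,b_k(\lambda)\,f(\lambda)^2\,\mu(\mathrm d\lambda),\qquad j,k\in\{1,2\}.$$ Finally let $$h(y_1,y_2)=\left(\frac{y_1}{a_1\!\left(\tfrac12\log_2(y_2/y_1)\right)},\ \tfrac12\log_2(y_2/y_1)\right).$$ Then $Q_{r,n}$ is integrable and $q_r:=E[Q_{r,n}]=E[(D_{[r]}X_0)^2]$ does not depend on $n>2r$ ($r=1,2$);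 $h$ is differentiable at $(q_1,q_2)$; the series $f_X(\lambda)$ converges for almost every $\lambda\in\mathbb T^2$ and $f\in L^2(\mathbb T^2,\mu)$; and, with $J=\nabla h(q_1,q_2)$ the Jacobian matrix of $h$ at $(q_1,q_2)$, the matrix $J\Sigma J^{\top}$ is positive semidefinite. Moreover, as $n\to\infty$: \begin{itemize} \item (Consistency) $(\widehat\phi_1,\widehat\phi_2)\to(\phi_1,\phi_2)$ in probability. \item (Asymptotic normality) $\displaystyle \sqrt N\begin{pmatrix}\widehat\phi_1-\phi_1\\ \widehat\phi_2-\phi_2\end{pmatrix}\Rightarrow\mathcal N\bigl(0,\,J\,\Sigma\,J^{\top}\bigr)$ in distribution. \end{itemize} -/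

import Mathlib

open MeasureTheory ProbabilityTheory Filter Topology

noncomputable section

namespace PowerLawIRF

/-- The plane `ℝ²` with its Euclidean norm. -/
abbrev Plane : Type := EuclideanSpace ℝ (Fin 2)

/-- The power-law generalized covariance `K(h) = φ₁ Γ(-φ₂) ‖h‖^(2φ₂)` (for non-integer `φ₂ > 0`). -/
def genCov (φ₁ φ₂ : ℝ) (h : Plane) : ℝ :=
  φ₁ * Real.Gamma (-φ₂) * ‖h‖ ^ (2 * φ₂)

/-- `X` is a (centred) Gaussian intrinsic random function of order `0` on `ℝ²` with the power-law
generalized covariance: every finite linear combination `∑ c(x) X(x)` that annihilates constants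
is Gaussian with mean zero and variance `∑∑ c(x) c(y) K(x - y)`. -/
structure IsPowerLawIRF {Ω : Type*} [MeasurableSpace Ω] (P : Measure Ω) (φ₁ φ₂ : ℝ)
    (X : Plane → Ω → ℝ) : Prop where
  gaussian : ∀ (s : Finset Plane) (c : Plane → ℝ), ∑ x ∈ s, c x = 0 →
    HasGaussianLaw (fun ω => ∑ x ∈ s, c x * X x ω) P
  mean_zero : ∀ (s : Finset Plane) (c : Plane → ℝ), ∑ x ∈ s, c x = 0 →
    ∫ ω, (∑ x ∈ s, c x * X x ω) ∂P = 0
  variance_eq : ∀ (s : Finset Plane) (c : Plane → ℝ), ∑ x ∈ s, c x = 0 →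
    Var[fun ω => ∑ x ∈ s, c x * X x ω; P] =
      ∑ x ∈ s, ∑ y ∈ s, c x * c y * genCov φ₁ φ₂ (x - y)

section Estimators

variable {Ω : Type*}

/-- The lattice point `(a, b)` as a point of the plane. -/
def site (a b : ℕ) : Plane := !₂[(a : ℝ), (b : ℝ)]

/-- First-order bilinear difference at step `r`:
`X_t - X_{t+re₁} - X_{t+re₂} + X_{t+re₁+re₂}` at `t = (t.1, t.2)`. -/
def bilinDiff (X : Plane → Ω → ℝ) (r : ℕ) (t : ℕ × ℕ) (ω : Ω) : ℝ :=
  X (site t.1 t.2) ω - X (site (t.1 + r) t.2) ω - X (site t.1 (t.2 + r)) ω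
    + X (site (t.1 + r) (t.2 + r)) ω

/-- The square grid `Λ_k = {0, …, k-1}²`. -/
def grid (k : ℕ) : Finset (ℕ × ℕ) := Finset.range k ×ˢ Finset.range k

/-- The quadratic variation `Q_r` computed from the observations on `Λ_n`: the average of the
squared differences over `Λ_{n-2r}` (used for `n > 2r`). -/
def quadVar (X : Plane → Ω → ℝ) (r n : ℕ) (ω : Ω) : ℝ :=
  ((grid (n - 2 * r)).card : ℝ)⁻¹ * ∑ t ∈ grid (n - 2 * r), bilinDiff X r t ω ^ 2

/-- `a₁(φ) = |Γ(-φ)| (8 - 4·2^φ)`. -/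
def aOne (φ : ℝ) : ℝ := |Real.Gamma (-φ)| * (8 - 4 * (2 : ℝ) ^ φ)

/-- `φ̂₂ = ½ log₂(Q₂ / Q₁)`. -/
def phiHatTwo (X : Plane → Ω → ℝ) (n : ℕ) (ω : Ω) : ℝ :=
  1 / 2 * Real.logb 2 (quadVar X 2 n ω / quadVar X 1 n ω)

/-- `φ̂₁ = Q₁ / a₁(φ̂₂)`. -/
def phiHatOne (X : Plane → Ω → ℝ) (n : ℕ) (ω : Ω) : ℝ :=
  quadVar X 1 n ω / aOne (phiHatTwo X n ω)

/-- The mean `q_r` of the squared bilinear difference at step `r`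
(the common value of `E[Q_r]` over all `n > 2r`). -/
def meanSq [MeasurableSpace Ω] (P : Measure Ω) (X : Plane → Ω → ℝ) (r : ℕ) : ℝ :=
  ∫ ω, bilinDiff X r (0, 0) ω ^ 2 ∂P

end Estimators

/-- The delta map `h(y₁, y₂) = (y₁ / a₁(½ log₂(y₂/y₁)), ½ log₂(y₂/y₁))`. -/
def deltaMap (y : Plane) : Plane :=
  !₂[y 0 / aOne (1 / 2 * Real.logb 2 (y 1 / y 0)), 1 / 2 * Real.logb 2 (y 1 / y 0)]

/-- The Jacobian matrix `(∂hᵢ/∂yⱼ)` of the delta map at `y`. -/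
def jacobian (y : Plane) : Matrix (Fin 2) (Fin 2) ℝ :=
  Matrix.of fun i j => (fderiv ℝ deltaMap y (EuclideanSpace.single j 1)) i

/-- The spectral density `f₀(λ) = c ‖λ‖^(-(2+2φ₂))` of the power-law field on `ℝ²`, with
`c = π 2^(2+2φ₂) Γ(1+φ₂) φ₁`, for the convention
`K(h) = (2π)⁻² ∫ e^{i⟨h,λ⟩} f₀(λ) dλ` (as generalized functions, modulo constants). -/
def specDensity (φ₁ φ₂ : ℝ) (l : Plane) : ℝ :=
  (Real.pi * (2 : ℝ) ^ (2 + 2 * φ₂) * Real.Gamma (1 + φ₂)) * φ₁ * ‖l‖ ^ (-(2 + 2 * φ₂))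

/-- The aliased (lattice) spectral density `f_X(λ) = ∑_{m ∈ ℤ²} f₀(λ + 2πm)`. -/
def latticeDensity (φ₁ φ₂ : ℝ) (l : Plane) : ℝ :=
  ∑' m : ℤ × ℤ, specDensity φ₁ φ₂ (l + !₂[2 * Real.pi * (m.1 : ℝ), 2 * Real.pi * (m.2 : ℝ)])

/-- The symbol `g(λ) = (1 - e^{iλ₁})(1 - e^{iλ₂})` of the bilinear difference at step `1`. -/
def symbolOne (l : Plane) : ℂ :=
  (1 - Complex.exp (Complex.I * (l 0 : ℂ))) * (1 - Complex.exp (Complex.I * (l 1 : ℂ)))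

/-- The spectral density `|g|² f_X` of the stationary field of bilinear differences at step `1`. -/
def diffDensity (φ₁ φ₂ : ℝ) (l : Plane) : ℝ :=
  ‖symbolOne l‖ ^ 2 * latticeDensity φ₁ φ₂ l

/-- The torus `(-π, π]²`. -/
def torus : Set Plane := {l | ∀ i, l i ∈ Set.Ioc (-Real.pi) Real.pi}

/-- The normalized Lebesgue measure `(2π)⁻² dλ` on the torus. -/
def torusMeasure : Measure Plane :=
  ENNReal.ofReal (((2 * Real.pi) ^ 2)⁻¹) • (volume : Measure Plane).restrict torus

/-- The symbols `b₁ = 1` and `b₂(λ) = 16 cos²(λ₁/2) cos²(λ₂/2)`. -/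
def formSymbol (l : Plane) : Fin 2 → ℝ :=
  ![1, 16 * Real.cos (l 0 / 2) ^ 2 * Real.cos (l 1 / 2) ^ 2]

/-- The matrix `Σ_{jk} = 2 ∫ b_j b_k f² dμ`, where `f` is the spectral density of the
differenced field. -/
def sigmaMatrix (φ₁ φ₂ : ℝ) : Matrix (Fin 2) (Fin 2) ℝ :=
  Matrix.of fun j k =>
    2 * ∫ l, formSymbol l j * formSymbol l k * diffDensity φ₁ φ₂ l ^ 2 ∂torusMeasure

/-- The asymptotic covariance matrix `J Σ Jᵀ`, with `J` the Jacobian of the delta map at `q`. -/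
def limitCov (φ₁ φ₂ : ℝ) (q : Plane) : Matrix (Fin 2) (Fin 2) ℝ :=
  jacobian q * sigmaMatrix φ₁ φ₂ * (jacobian q).transpose

end PowerLawIRF

end

open PowerLawIRF

/-! ### Gamma integrals for the power law and its spectral density. -/

namespace PowerLawIRF

open Set

/-! The proof rests on the Gaussian mixture `Γ(-p) a^p = ∫ u^(-p-1) (e^(-ua) - 1) du` over `u > 0`,
for `0 < p < 1`. On contrasts of total mass zero the `-1` disappears, and `e^(-u‖h‖²)` factors over
the coordinates. Hence two bilinear differences, of steps `r` and `s`, have covariance `φ₁ ∫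
u^(-φ₂-1) k(u,x) k(u,y) du` (`lagCov`), where `k` is a double difference of `e^(-ux²)` on `ℤ`. The
`ℓ¹` norm of `k(u,·)` is `O(min(√u, 1))`, so the product costs `min(u, 1)`, which is integrable
against `u^(-φ₂-1)`: the differenced field has absolutely summable covariances
(`summable_abs_lagCov`).

Poisson summation in each coordinate identifies the Fourier series of these covariances with the
aliased density, up to the difference symbols (`norm_tsum_lagCov_sq`). Parseval then gives `Σ_jk = 2
∑ lagCov²` (`sigmaMatrix_apply`), the limit of `n² Cov(Q_j, Q_k)`.

A linear combination of the `Q_r` is a quadratic form in a Gaussian vector. Diagonalised, it is a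
weighted sum of independent `χ²₁` variables. The weights are at most (coefficient size) × (row sum
of the covariance) `= O(1/n)`, and their squares sum to a quantity tending to `θᵀΣθ/2`, so the
characteristic function tends to the Gaussian one (`quadForm_charFun_bound`,
`tendsto_charFun_quadVar`).

Finally `q_r = φ₁ a₁(φ₂) r^(2φ₂)`, so `h(q) = (φ₁, φ₂)`. Tightness of `n(Q - q)` yields consistency,
and the delta method yields the limit law. -/

lemma integrableOn_rpow_mul_min {p : ℝ} (hp : 0 < p) (hp1 : p < 1) :
    IntegrableOn (fun u : ℝ => u ^ (-p - 1) * min u 1) (Ioi 0) := by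
  rw [← Ioc_union_Ioi_eq_Ioi (zero_le_one' ℝ)]
  refine IntegrableOn.union ?_ ?_
  · have h : IntegrableOn (fun u : ℝ => u ^ (-p)) (Ioc 0 1) :=
      (intervalIntegrable_iff_integrableOn_Ioc_of_le zero_le_one).1
        (intervalIntegral.intervalIntegrable_rpow' (by linarith))
    refine h.congr_fun (fun u hu => ?_) measurableSet_Ioc
    simp only
    rw [min_eq_left hu.2, ← Real.rpow_add_one hu.1.ne']
    ring_nf
  · refine (integrableOn_Ioi_rpow_of_lt (a := -p - 1) (by linarith) one_pos).congr_fun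
      (fun u hu => ?_) measurableSet_Ioi
    simp only
    rw [min_eq_right (le_of_lt hu), mul_one]

lemma integrableOn_rpow_mul_of_abs_le {p : ℝ} (hp : 0 < p) (hp1 : p < 1) {g : ℝ → ℝ} {C : ℝ}
    (hg : AEStronglyMeasurable g (volume.restrict (Ioi 0)))
    (hC : ∀ u, 0 < u → |g u| ≤ C * min u 1) :
    IntegrableOn (fun u : ℝ => u ^ (-p - 1) * g u) (Ioi 0) := by
  refine Integrable.mono' ((integrableOn_rpow_mul_min hp hp1).const_mul C)
    (AEStronglyMeasurable.mul (by fun_prop) hg) ?_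
  filter_upwards [ae_restrict_mem measurableSet_Ioi] with u hu
  have hu0 : 0 ≤ u ^ (-p - 1) := Real.rpow_nonneg (le_of_lt hu) _
  rw [Real.norm_eq_abs, abs_mul, abs_of_nonneg hu0]
  nlinarith [mul_le_mul_of_nonneg_left (hC u hu) hu0]

lemma one_sub_exp_le_min {a u : ℝ} (ha : 0 ≤ a) (hu : 0 < u) :
    |Real.exp (-(u * a)) - 1| ≤ (a + 1) * min u 1 := by
  have h1 : Real.exp (-(u * a)) ≤ 1 := Real.exp_le_one_iff.2 (by nlinarith)
  have h2 : -(u * a) + 1 ≤ Real.exp (-(u * a)) := Real.add_one_le_exp _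
  have h3 := Real.exp_pos (-(u * a))
  rw [abs_of_nonpos (by linarith)]
  rcases le_total u 1 with h | h
  · rw [min_eq_left h]; nlinarith
  · rw [min_eq_right h]; nlinarith

lemma integrableOn_rpow_mul_exp_sub_one {p a : ℝ} (hp : 0 < p) (hp1 : p < 1) (ha : 0 ≤ a) :
    IntegrableOn (fun u : ℝ => u ^ (-p - 1) * (Real.exp (-(u * a)) - 1)) (Ioi 0) :=
  integrableOn_rpow_mul_of_abs_le hp hp1 (by fun_prop) (fun _ hu => one_sub_exp_le_min ha hu)

lemma tendsto_rpow_mul_exp_sub_one_zero {p a : ℝ} (hp1 : p < 1) (ha : 0 ≤ a) :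
    Tendsto (fun u : ℝ => u ^ (-p) * (Real.exp (-(u * a)) - 1)) (𝓝[>] 0) (𝓝 0) := by
  have h : Tendsto (fun u : ℝ => (a + 1) * u ^ (1 - p)) (𝓝[>] 0) (𝓝 0) := by
    have : ContinuousAt (fun u : ℝ => (a + 1) * u ^ (1 - p)) 0 :=
      (Real.continuousAt_rpow_const 0 (1 - p) (Or.inr (by linarith))).const_mul _
    have h2 := this.tendsto
    simp only [Real.zero_rpow (by linarith : 1 - p ≠ 0), mul_zero] at h2
    exact h2.mono_left nhdsWithin_le_nhds
  refine squeeze_zero_norm' ?_ h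
  filter_upwards [self_mem_nhdsWithin] with u hu
  have hu' : 0 < u := hu
  rw [Real.norm_eq_abs, abs_mul, abs_of_pos (Real.rpow_pos_of_pos hu' _),
    show (1 - p) = -p + 1 by ring, Real.rpow_add_one hu'.ne']
  have := one_sub_exp_le_min ha hu'
  have h3 := Real.rpow_pos_of_pos hu' (-p)
  have h4 : (a + 1) * min u 1 ≤ (a + 1) * u := by gcongr; exact min_le_left _ _
  nlinarith

lemma tendsto_rpow_mul_exp_sub_one_atTop {p a : ℝ} (hp : 0 < p) (ha : 0 ≤ a) :
    Tendsto (fun u : ℝ => u ^ (-p) * (Real.exp (-(u * a)) - 1)) atTop (𝓝 0) := by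
  refine squeeze_zero_norm' ?_ (by simpa using (tendsto_rpow_neg_atTop hp).const_mul (a + 1))
  filter_upwards [eventually_gt_atTop 0] with u hu
  have h3 := Real.rpow_pos_of_pos hu (-p)
  rw [Real.norm_eq_abs, abs_mul, abs_of_pos h3]
  have := one_sub_exp_le_min ha hu
  have h4 : (a + 1) * min u 1 ≤ (a + 1) * 1 := by gcongr; exact min_le_right _ _
  nlinarith

/-- The Gamma integral on the strip `-1 < Re s < 0`. -/
lemma integral_rpow_mul_exp_sub_one {p a : ℝ} (hp : 0 < p) (hp1 : p < 1) (ha : 0 ≤ a) :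
    ∫ u in Ioi (0 : ℝ), u ^ (-p - 1) * (Real.exp (-(u * a)) - 1) = Real.Gamma (-p) * a ^ p := by
  rcases ha.eq_or_lt with rfl | ha0
  · simp [Real.zero_rpow hp.ne']
  -- Integration by parts: `G` vanishes at `0` and at `∞`, so its derivative integrates to zero.
  -- This expresses the integral through `Γ(1-p) = -p Γ(-p)`.
  set G : ℝ → ℝ := fun u => u ^ (-p) * (Real.exp (-(u * a)) - 1)
  have hint1 := integrableOn_rpow_mul_exp_sub_one hp hp1 ha
  have hint2 : IntegrableOn (fun u : ℝ => u ^ (1 - p - 1) * Real.exp (-(a * u))) (Ioi 0) := by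
    have := integrableOn_rpow_mul_exp_neg_mul_rpow (p := 1) (s := 1 - p - 1) (b := a)
      (by linarith) one_pos ha0
    simpa using this
  have hval2 := Real.integral_rpow_mul_exp_neg_mul_Ioi (a := 1 - p) (r := a) (by linarith) ha0
  have hderiv : ∀ u ∈ Ioi (0 : ℝ), HasDerivAt G
      (-p * (u ^ (-p - 1) * (Real.exp (-(u * a)) - 1)) +
        -a * (u ^ (1 - p - 1) * Real.exp (-(a * u)))) u := by
    intro u hu
    have h1 : HasDerivAt (fun u : ℝ => u ^ (-p)) (-p * u ^ (-p - 1)) u :=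
      Real.hasDerivAt_rpow_const (Or.inl (ne_of_gt hu))
    have h2 : HasDerivAt (fun u : ℝ => Real.exp (-(u * a)) - 1)
        (Real.exp (-(u * a)) * (-(1 * a))) u :=
      (((hasDerivAt_id u).mul_const a).neg.exp).sub_const 1
    refine (h1.mul h2).congr_deriv ?_
    rw [show 1 - p - 1 = -p by ring, mul_comm a u]
    ring
  have hcont : ContinuousWithinAt G (Ici 0) 0 := by
    rw [← continuousWithinAt_Ioi_iff_Ici, ContinuousWithinAt]
    simpa [G] using tendsto_rpow_mul_exp_sub_one_zero hp1 ha
  have key := integral_Ioi_of_hasDerivAt_of_tendsto hcont hderiv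
    ((hint1.const_mul _).add (hint2.const_mul _)) (tendsto_rpow_mul_exp_sub_one_atTop hp ha)
  rw [integral_add (hint1.const_mul _) (hint2.const_mul _), integral_const_mul,
    integral_const_mul, hval2] at key
  have hG0 : G 0 = 0 := by simp [G]
  rw [hG0] at key
  have hGam : Real.Gamma (1 - p) = -p * Real.Gamma (-p) := by
    rw [← Real.Gamma_add_one (by linarith : -p ≠ 0)]; ring_nf
  rw [hGam, one_div, Real.inv_rpow ha, ← Real.rpow_neg ha, show -(1 - p) = p - 1 by ring,
    Real.rpow_sub_one ha0.ne'] at key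
  field_simp at key
  simp only [sub_self, mul_zero, mul_eq_zero, hp.ne', false_or] at key
  linarith

lemma integrableOn_rpow_mul_exp_neg_div {p b : ℝ} (hp : 0 < p) (hb : 0 < b) :
    IntegrableOn (fun u : ℝ => u ^ (-p - 2) * Real.exp (-(b / u))) (Ioi 0) := by
  have h : IntegrableOn (fun u : ℝ => u ^ p * Real.exp (-(b * u))) (Ioi 0) := by
    simpa using integrableOn_rpow_mul_exp_neg_mul_rpow (p := 1) (s := p) (b := b)
      (by linarith) one_pos hb
  have h2 := (integrableOn_Ioi_comp_rpow_iff
    (fun u : ℝ => u ^ p * Real.exp (-(b * u))) (p := -1) (by norm_num)).2 h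
  refine h2.congr_fun (fun u hu => ?_) measurableSet_Ioi
  have hu' : (0 : ℝ) < u := hu
  simp only [smul_eq_mul]
  rw [Real.rpow_neg_one, Real.inv_rpow hu'.le, ← Real.rpow_neg hu'.le,
    abs_neg, abs_one, one_mul, ← mul_assoc, ← Real.rpow_add hu']
  ring_nf

/-- The substitution `u ↦ u⁻¹` reduces this to Euler's integral. With `b = ‖λ‖²/4` it produces the
power law `f₀`. -/
lemma integral_rpow_mul_exp_neg_div {p b : ℝ} (hp : 0 < p) (hb : 0 < b) :
    ∫ u in Ioi (0 : ℝ), u ^ (-p - 2) * Real.exp (-(b / u)) = Real.Gamma (1 + p) * b ^ (-(1 + p)) := by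
  have h := Real.integral_rpow_mul_exp_neg_mul_Ioi (a := 1 + p) (r := b) (by linarith) hb
  rw [one_div, Real.inv_rpow hb.le, ← Real.rpow_neg hb.le, mul_comm] at h
  rw [← h, ← integral_comp_rpow_Ioi _ (p := -1) (by norm_num)]
  refine setIntegral_congr_fun measurableSet_Ioi (fun u hu => ?_)
  have hu' : (0 : ℝ) < u := hu
  simp only [smul_eq_mul]
  rw [Real.rpow_neg_one, Real.inv_rpow hu'.le, ← Real.rpow_neg hu'.le,
    abs_neg, abs_one, one_mul, ← mul_assoc, ← Real.rpow_add hu']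
  ring_nf
  rw [inv_inv]

end PowerLawIRF

/-! ### `ℓ¹` bounds for differences of lattice Gaussians. -/

namespace PowerLawIRF

open Set

lemma summable_exp_neg_mul_int_add_sq {c : ℝ} (hc : 0 < c) (b : ℝ) :
    Summable fun n : ℤ => Real.exp (-(c * ((n : ℝ) + b) ^ 2)) := by
  -- The parameters make the exponent of the theta bound equal to `-cn² + 2c|b||n|`, which dominates
  -- `-c(n+b)²`.
  have h := summable_pow_mul_jacobiTheta₂_term_bound (c * |b| / Real.pi)
    (T := c / Real.pi) (by positivity) 0
  refine h.of_nonneg_of_le (fun _ => (Real.exp_pos _).le) (fun n => ?_)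
  rw [pow_zero, one_mul, Real.exp_le_exp]
  have h1 : -Real.pi * (c / Real.pi * (n : ℝ) ^ 2 - 2 * (c * |b| / Real.pi) * ((|n| : ℤ) : ℝ))
      = -(c * (n : ℝ) ^ 2) + 2 * c * (|b| * |(n : ℝ)|) := by
    push_cast
    field_simp
    ring
  rw [h1, ← abs_mul]
  nlinarith [neg_abs_le (b * (n : ℝ)), mul_nonneg hc.le (sq_nonneg b),
    mul_le_mul_of_nonneg_left (neg_abs_le (b * (n : ℝ))) hc.le]

/-- The Gaussian `exp (-u x²)` on the integers. -/
noncomputable def latGauss (u : ℝ) (x : ℤ) : ℝ := Real.exp (-(u * (x : ℝ) ^ 2))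

/-- The theta series `∑ₓ exp (-u x²)`. -/
noncomputable def latTheta (u : ℝ) : ℝ := ∑' x : ℤ, latGauss u x

lemma latGauss_pos (u : ℝ) (x : ℤ) : 0 < latGauss u x := Real.exp_pos _

lemma summable_latGauss {u : ℝ} (hu : 0 < u) : Summable (latGauss u) := by
  simpa [funext (latGauss.eq_def u)] using summable_exp_neg_mul_int_add_sq hu 0

lemma latTheta_pos {u : ℝ} (hu : 0 < u) : 0 < latTheta u :=
  (summable_latGauss hu).tsum_pos (fun x => (latGauss_pos u x).le) 0 (latGauss_pos u 0)

lemma latTheta_antitone {u v : ℝ} (hu : 0 < u) (huv : u ≤ v) : latTheta v ≤ latTheta u := by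
  refine (summable_latGauss (hu.trans_le huv)).tsum_le_tsum (fun x => ?_) (summable_latGauss hu)
  exact Real.exp_le_exp.2 (by nlinarith [sq_nonneg (x : ℝ)])

/-- The modular transformation gives `θ(u) = √(π/u) θ(π²/u)`, and `π²/u ≥ 1` when `u ≤ 1`. -/
lemma latTheta_le {u : ℝ} (hu : 0 < u) (hu1 : u ≤ 1) :
    latTheta u ≤ √(Real.pi / u) * latTheta 1 := by
  have h := Real.tsum_exp_neg_mul_int_sq (a := u / Real.pi) (by positivity)
  have h1 : latTheta u = ∑' n : ℤ, Real.exp (-Real.pi * (u / Real.pi) * (n : ℝ) ^ 2) := by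
    refine tsum_congr fun n => ?_
    rw [latGauss]
    congr 1
    field_simp
  have h2 : ∀ n : ℤ, Real.exp (-Real.pi / (u / Real.pi) * (n : ℝ) ^ 2) =
      latGauss (Real.pi ^ 2 / u) n := by
    intro n
    rw [latGauss]
    congr 1
    field_simp
  have h3 : (1 : ℝ) / (u / Real.pi) ^ (1 / 2 : ℝ) = √(Real.pi / u) := by
    rw [← Real.sqrt_eq_rpow, one_div, ← Real.sqrt_inv, inv_div]
  rw [h1, h, tsum_congr h2, h3]
  gcongr
  refine latTheta_antitone one_pos ?_
  rw [le_div_iff₀ hu]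
  nlinarith [Real.pi_gt_three]

/-- Lattice functions depending on a parameter `u > 0` whose `ℓ¹` norm is `O(min(√u, 1))`. -/
def IsSqrtBounded (g : ℝ → ℤ → ℝ) : Prop :=
  ∃ C : ℝ, ∀ u, 0 < u → (Summable fun x => |g u x|) ∧ ∑' x, |g u x| ≤ C * √(min u 1)

lemma IsSqrtBounded.add {g h : ℝ → ℤ → ℝ} (hg : IsSqrtBounded g) (hh : IsSqrtBounded h) :
    IsSqrtBounded fun u x => g u x + h u x := by
  obtain ⟨C, hC⟩ := hg
  obtain ⟨D, hD⟩ := hh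
  refine ⟨C + D, fun u hu => ?_⟩
  obtain ⟨h1, h2⟩ := hC u hu
  obtain ⟨h3, h4⟩ := hD u hu
  have hs : Summable fun x => |g u x + h u x| :=
    (h1.add h3).of_nonneg_of_le (fun _ => abs_nonneg _) (fun x => abs_add_le _ _)
  refine ⟨hs, ?_⟩
  calc ∑' x, |g u x + h u x| ≤ ∑' x, (|g u x| + |h u x|) :=
        hs.tsum_le_tsum (fun x => abs_add_le _ _) (h1.add h3)
    _ = ∑' x, |g u x| + ∑' x, |h u x| := h1.tsum_add h3
    _ ≤ (C + D) * √(min u 1) := by linarith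

lemma IsSqrtBounded.shift {g : ℝ → ℤ → ℝ} (hg : IsSqrtBounded g) (k : ℤ) :
    IsSqrtBounded fun u x => g u (x + k) := by
  obtain ⟨C, hC⟩ := hg
  refine ⟨C, fun u hu => ⟨?_, ?_⟩⟩
  · exact (Equiv.addRight k).summable_iff (f := fun x => |g u x|).2 (hC u hu).1
  · exact ((Equiv.addRight k).tsum_eq (fun x => |g u x|)).trans_le (hC u hu).2

/-- The covariance kernel of the first differences of step `r` and `s` for the
covariance `exp (-u x²)` on the line. -/
noncomputable def lagKernel (r s : ℤ) (u : ℝ) (x : ℤ) : ℝ :=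
  latGauss u x - latGauss u (x + r) - latGauss u (x - s) + latGauss u (x + r - s)

/-- The two neighbours add up to `2 e^(-u) cosh(2ux)` times the central value. -/
lemma latGauss_add_one_add_sub_one (u : ℝ) (x : ℤ) :
    2 * (Real.exp (-u) * latGauss u x) ≤ latGauss u (x + 1) + latGauss u (x - 1) := by
  have h1 : latGauss u (x + 1) = Real.exp (-u) * latGauss u x * Real.exp (-(2 * u * x)) := by
    rw [latGauss, latGauss, ← Real.exp_add, ← Real.exp_add]
    congr 1
    push_cast
    ring
  have h2 : latGauss u (x - 1) = Real.exp (-u) * latGauss u x * Real.exp (2 * u * x) := by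
    rw [latGauss, latGauss, ← Real.exp_add, ← Real.exp_add]
    congr 1
    push_cast
    ring
  have h3 : 0 < Real.exp (-u) * latGauss u x := mul_pos (Real.exp_pos _) (latGauss_pos u x)
  have h4 : 2 ≤ Real.exp (-(2 * u * x)) + Real.exp (2 * u * x) := by
    have := Real.one_le_cosh (2 * u * x)
    rw [Real.cosh_eq] at this
    linarith
  rw [h1, h2]
  nlinarith

/-- With `g` the Gaussian, the kernel is `2(1-e^(-u)) g(x)` minus `g(x+1) + g(x-1) - 2e^(-u) g(x)`,
both nonnegative, so its modulus is at most their sum. That bound sums over `ℤ` in closed form. -/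
lemma abs_lagKernel_one_le {u : ℝ} (hu : 0 < u) (x : ℤ) :
    |lagKernel 1 1 u x| ≤ (2 - 4 * Real.exp (-u)) * latGauss u x +
      (latGauss u (x + 1) + latGauss u (x - 1)) := by
  have he : Real.exp (-u) ≤ 1 := Real.exp_le_one_iff.2 (by linarith)
  have h1 := latGauss_add_one_add_sub_one u x
  have h2 : lagKernel 1 1 u x = 2 * latGauss u x - (latGauss u (x + 1) + latGauss u (x - 1)) := by
    rw [lagKernel, add_sub_cancel_right]; ring
  have h3 : 0 ≤ (1 - Real.exp (-u)) * latGauss u x :=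
    mul_nonneg (by linarith) (latGauss_pos u x).le
  have h4 : (2 - 4 * Real.exp (-u)) * latGauss u x =
    2 * latGauss u x - 4 * (Real.exp (-u) * latGauss u x) := by ring
  rw [sub_mul, one_mul] at h3
  rw [h2, h4, abs_le]
  constructor <;> linarith

lemma hasSum_latGauss_add {u : ℝ} (hu : 0 < u) (k : ℤ) :
    HasSum (fun x : ℤ => latGauss u (x + k)) (latTheta u) :=
  (Equiv.addRight k).hasSum_iff (f := latGauss u).2 (summable_latGauss hu).hasSum

lemma tsum_abs_lagKernel_one {u : ℝ} (hu : 0 < u) :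
    (Summable fun x => |lagKernel 1 1 u x|) ∧
      ∑' x, |lagKernel 1 1 u x| ≤ 4 * (1 - Real.exp (-u)) * latTheta u := by
  have hsum := ((summable_latGauss hu).hasSum.mul_left (2 - 4 * Real.exp (-u))).add
    ((hasSum_latGauss_add hu 1).add (hasSum_latGauss_add hu (-1)))
  have hs : Summable fun x => |lagKernel 1 1 u x| :=
    hsum.summable.of_nonneg_of_le (fun _ => abs_nonneg _) (abs_lagKernel_one_le hu)
  refine ⟨hs, (hs.tsum_le_tsum (abs_lagKernel_one_le hu) hsum.summable).trans_eq
    (hsum.tsum_eq.trans ?_)⟩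
  rw [← latTheta]
  ring

/-- Here `1 - e^(-u) ≤ min(u, 1)`, while `θ(u) = O(u^(-1/2))` for `u ≤ 1`; the product is of order
`√u` near zero. -/
lemma isSqrtBounded_lagKernel_one : IsSqrtBounded (lagKernel 1 1) := by
  refine ⟨4 * (√Real.pi * latTheta 1), fun u hu => ⟨(tsum_abs_lagKernel_one hu).1,
    (tsum_abs_lagKernel_one hu).2.trans ?_⟩⟩
  have hθ := latTheta_pos one_pos
  have hθu := latTheta_pos hu
  have he := Real.add_one_le_exp (-u)
  have he' := Real.exp_pos (-u)
  rcases le_total u 1 with h | h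
  · rw [min_eq_left h]
    have h1 := latTheta_le hu h
    rw [Real.sqrt_div Real.pi_pos.le] at h1
    have hsu : 0 < √u := Real.sqrt_pos.2 hu
    have h2 : u * (√Real.pi / √u * latTheta 1) = √Real.pi * latTheta 1 * √u := by
      nth_rewrite 1 [← Real.mul_self_sqrt hu.le]
      field_simp
    nlinarith
  · rw [min_eq_right h, Real.sqrt_one]
    have h1 := latTheta_antitone one_pos h
    have h2 : 1 ≤ √Real.pi := Real.one_le_sqrt.2 (by linarith [Real.pi_gt_three])
    nlinarith

/-- A difference of step `r` is a sum of `r` translates of the unit difference, and translation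
preserves the `ℓ¹` norm. -/
lemma isSqrtBounded_lagKernel (r s : ℕ) : IsSqrtBounded (lagKernel r s) := by
  have h1 : ∀ s : ℕ, IsSqrtBounded (lagKernel 1 s) := by
    intro s
    induction s with
    | zero =>
      refine ⟨0, fun u _ => ?_⟩
      simp [lagKernel]
    | succ s ih =>
      convert ih.add (isSqrtBounded_lagKernel_one.shift (-(s : ℤ))) using 3 with u x
      simp only [lagKernel]
      push_cast
      ring_nf
  induction r with
  | zero =>
    refine ⟨0, fun u _ => ?_⟩
    simp [lagKernel]
  | succ r ih =>
    convert ih.add ((h1 s).shift r) using 3 with u x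
    simp only [lagKernel]
    push_cast
    ring_nf

end PowerLawIRF

/-! ### Summable lattice covariances and their Fourier series. -/

namespace PowerLawIRF

open Set

/-- The lattice covariance with Gaussian-mixture representation
`φ₁ ∫ u^(-φ₂-1) k(u,x) k(u,y) du`, `k = lagKernel r s`. -/
noncomputable def lagCov (φ₁ φ₂ : ℝ) (r s : ℤ) (h : ℤ × ℤ) : ℝ :=
  φ₁ * ∫ u in Ioi (0 : ℝ), u ^ (-φ₂ - 1) * (lagKernel r s u h.1 * lagKernel r s u h.2)

lemma continuous_lagKernel (r s x : ℤ) : Continuous fun u => lagKernel r s u x := by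
  unfold lagKernel latGauss
  fun_prop

/-- On `ℤ²` the `ℓ¹` norm of the product kernel is the square of the one-dimensional norm, so `√(min
u 1)` becomes `min u 1`. -/
lemma exists_sum_abs_lagKernel_mul_le (r s : ℕ) :
    ∃ C : ℝ, ∀ u, 0 < u → (Summable fun x => |lagKernel r s u x|) ∧
      (∀ S : Finset (ℤ × ℤ), ∑ h ∈ S, |lagKernel r s u h.1 * lagKernel r s u h.2| ≤ C * min u 1) ∧
      (∑' x, |lagKernel r s u x|) ^ 2 ≤ C * min u 1 := by
  obtain ⟨C, hC⟩ := isSqrtBounded_lagKernel r s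
  refine ⟨C ^ 2, fun u hu => ?_⟩
  obtain ⟨h1, h2⟩ := hC u hu
  have hsq : (∑' x, |lagKernel r s u x|) ^ 2 ≤ C ^ 2 * min u 1 := by
    have := pow_le_pow_left₀ (tsum_nonneg fun x => abs_nonneg (lagKernel r s u x)) h2 2
    rwa [mul_pow, Real.sq_sqrt (le_min hu.le zero_le_one)] at this
  refine ⟨h1, fun S => le_trans ?_ hsq, hsq⟩
  have hprod : Summable fun h : ℤ × ℤ => |lagKernel r s u h.1| * |lagKernel r s u h.2| :=
    h1.mul_of_nonneg h1 (fun _ => abs_nonneg _) (fun _ => abs_nonneg _)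
  rw [sq, h1.tsum_mul_tsum h1 hprod]
  simp_rw [abs_mul]
  exact hprod.sum_le_tsum S fun h _ => by positivity

lemma integrableOn_lagKernel {p : ℝ} (hp : 0 < p) (hp1 : p < 1) (r s : ℕ) (x y : ℤ) :
    IntegrableOn (fun u : ℝ => u ^ (-p - 1) * (lagKernel r s u x * lagKernel r s u y)) (Ioi 0) := by
  obtain ⟨C, hC⟩ := exists_sum_abs_lagKernel_mul_le r s
  refine integrableOn_rpow_mul_of_abs_le (C := C) hp hp1
    (((continuous_lagKernel _ _ x).mul (continuous_lagKernel _ _ y)).aestronglyMeasurable)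
    fun u hu => ?_
  simpa using (hC u hu).2.1 {(x, y)}

lemma summable_integral_abs_lagKernel {p : ℝ} (hp : 0 < p) (hp1 : p < 1) (r s : ℕ) :
    Summable fun h : ℤ × ℤ => ∫ u in Ioi (0 : ℝ),
      |u ^ (-p - 1) * (lagKernel r s u h.1 * lagKernel r s u h.2)| := by
  obtain ⟨C, hC⟩ := exists_sum_abs_lagKernel_mul_le r s
  refine summable_of_sum_le (c := ∫ u in Ioi (0 : ℝ), C * (u ^ (-p - 1) * min u 1))
    (fun h => integral_nonneg fun u => abs_nonneg _) fun S => ?_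
  rw [← integral_finsetSum _ fun h _ => (integrableOn_lagKernel hp hp1 r s h.1 h.2).abs]
  refine setIntegral_mono_on
    (integrable_finsetSum _ fun h _ => (integrableOn_lagKernel hp hp1 r s h.1 h.2).abs)
    ((integrableOn_rpow_mul_min hp hp1).const_mul C) measurableSet_Ioi fun u hu => ?_
  have hu0 : 0 ≤ u ^ (-p - 1) := Real.rpow_nonneg (le_of_lt hu) _
  simp_rw [abs_mul (u ^ (-p - 1)), abs_of_nonneg hu0]
  rw [← Finset.mul_sum]
  nlinarith [mul_le_mul_of_nonneg_left ((hC u hu).2.1 S) hu0]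

lemma summable_abs_lagCov (φ₁ : ℝ) {φ₂ : ℝ} (hp : 0 < φ₂) (hp1 : φ₂ < 1) (r s : ℕ) :
    Summable fun h => |lagCov φ₁ φ₂ r s h| := by
  refine ((summable_integral_abs_lagKernel hp hp1 r s).mul_left |φ₁|).of_nonneg_of_le
    (fun _ => abs_nonneg _) fun h => ?_
  rw [lagCov, abs_mul]
  gcongr
  exact abs_integral_le_integral_abs

/-- The character `h ↦ exp (i⟨h, l⟩)` of `ℤ²`. -/
noncomputable def latChar (l : Plane) (h : ℤ × ℤ) : ℂ :=
  Complex.exp (((h.1 * l 0 : ℝ) : ℂ) * Complex.I) * Complex.exp (((h.2 * l 1 : ℝ) : ℂ) * Complex.I)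

lemma norm_latChar (l : Plane) (h : ℤ × ℤ) : ‖latChar l h‖ = 1 := by
  rw [latChar, norm_mul, Complex.norm_exp_ofReal_mul_I, Complex.norm_exp_ofReal_mul_I, one_mul]

/-- The Fourier series of `lagKernel r s u`. -/
noncomputable def kernelFourier (r s : ℤ) (u t : ℝ) : ℂ :=
  ∑' x : ℤ, (lagKernel r s u x : ℂ) * Complex.exp (((x * t : ℝ) : ℂ) * Complex.I)

/-- Sum and mixture integral are interchanged by absolute summability; for fixed `u` the double
series is a product of two single ones. -/
lemma hasSum_lagCov_mul_latChar (φ₁ : ℝ) {φ₂ : ℝ} (hp : 0 < φ₂) (hp1 : φ₂ < 1) (r s : ℕ)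
    (l : Plane) :
    HasSum (fun h => (lagCov φ₁ φ₂ r s h : ℂ) * latChar l h)
      (φ₁ * ∫ u in Ioi (0 : ℝ), ((u ^ (-φ₂ - 1) : ℝ) : ℂ) *
        (kernelFourier r s u (l 0) * kernelFourier r s u (l 1))) := by
  set F : ℤ × ℤ → ℝ → ℂ := fun h u =>
    ((u ^ (-φ₂ - 1) * (lagKernel r s u h.1 * lagKernel r s u h.2) : ℝ) : ℂ) * latChar l h
  have hint : ∀ h, IntegrableOn (F h) (Ioi 0) := fun h =>
    (integrableOn_lagKernel hp hp1 r s h.1 h.2).ofReal.mul_const _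
  have hnorm : ∀ h u, ‖F h u‖ = |u ^ (-φ₂ - 1) * (lagKernel r s u h.1 * lagKernel r s u h.2)| := by
    intro h u
    rw [norm_mul, norm_latChar, mul_one, Complex.norm_real, Real.norm_eq_abs]
  have hsum : Summable fun h => ∫ u in Ioi (0 : ℝ), ‖F h u‖ := by
    simp_rw [hnorm]
    exact summable_integral_abs_lagKernel hp hp1 r s
  have key := (hasSum_integral_of_summable_integral_norm hint hsum).mul_left (φ₁ : ℂ)
  have hA : ∀ h, (lagCov φ₁ φ₂ r s h : ℂ) * latChar l h = φ₁ * ∫ u in Ioi (0 : ℝ), F h u := by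
    intro h
    simp only [F]
    rw [integral_mul_const, integral_complex_ofReal, lagCov]
    push_cast
    ring
  have hB : ∫ u in Ioi (0 : ℝ), ((u ^ (-φ₂ - 1) : ℝ) : ℂ) *
      (kernelFourier r s u (l 0) * kernelFourier r s u (l 1)) =
      ∫ u in Ioi (0 : ℝ), ∑' h, F h u := by
    refine setIntegral_congr_fun measurableSet_Ioi fun u hu => ?_
    obtain ⟨C, hC⟩ := isSqrtBounded_lagKernel r s
    have hn : ∀ t : ℝ, Summable fun x : ℤ =>
        ‖(lagKernel r s u x : ℂ) * Complex.exp (((x * t : ℝ) : ℂ) * Complex.I)‖ := by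
      intro t
      simp_rw [norm_mul, Complex.norm_exp_ofReal_mul_I, mul_one, Complex.norm_real, Real.norm_eq_abs]
      exact (hC u hu).1
    simp only [F, kernelFourier]
    rw [tsum_mul_tsum_of_summable_norm (hn _) (hn _), ← tsum_mul_left]
    refine tsum_congr fun h => ?_
    rw [latChar]
    push_cast
    ring
  rw [funext hA, hB]
  exact key

/-- The periodised Gaussian `√(π/u) ∑ₙ exp (-(t + 2πn)²/(4u))`. -/
noncomputable def periodGauss (u t : ℝ) : ℝ :=
  ∑' n : ℤ, √(Real.pi / u) * Real.exp (-((t + 2 * Real.pi * n) ^ 2 / (4 * u)))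

lemma summable_periodGauss {u : ℝ} (hu : 0 < u) (t : ℝ) :
    Summable fun n : ℤ => √(Real.pi / u) * Real.exp (-((t + 2 * Real.pi * n) ^ 2 / (4 * u))) := by
  have h := summable_exp_neg_mul_int_add_sq (c := Real.pi ^ 2 / u) (by positivity)
    (t / (2 * Real.pi))
  refine (h.congr fun n => ?_).mul_left _
  congr 1
  field_simp
  ring

lemma periodGauss_nonneg (u t : ℝ) : 0 ≤ periodGauss u t :=
  tsum_nonneg fun _ => by positivity

lemma summable_latGauss_mul_exp {u : ℝ} (hu : 0 < u) (t : ℝ) :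
    Summable fun x : ℤ => (latGauss u x : ℂ) * Complex.exp (((x * t : ℝ) : ℂ) * Complex.I) := by
  refine Summable.of_norm ((summable_latGauss hu).congr fun x => ?_)
  rw [norm_mul, Complex.norm_exp_ofReal_mul_I, mul_one, Complex.norm_real, Real.norm_eq_abs,
    abs_of_pos (latGauss_pos u x)]

/-- Poisson summation for the Gaussian. -/
lemma hasSum_latGauss_mul_exp {u : ℝ} (hu : 0 < u) (t : ℝ) :
    HasSum (fun x : ℤ => (latGauss u x : ℂ) * Complex.exp (((x * t : ℝ) : ℂ) * Complex.I))
      (periodGauss u t) := by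
  have hpi : (Real.pi : ℂ) ≠ 0 := Complex.ofReal_ne_zero.2 Real.pi_ne_zero
  have hu' : (u : ℂ) ≠ 0 := Complex.ofReal_ne_zero.2 hu.ne'
  have h := Complex.tsum_exp_neg_quadratic (a := ((u / Real.pi : ℝ) : ℂ))
    (by rw [Complex.ofReal_re]; positivity) (Complex.I * (t / (2 * Real.pi)))
  have h1 : ∀ n : ℤ, Complex.exp (-Real.pi * ((u / Real.pi : ℝ) : ℂ) * (n : ℂ) ^ 2 +
      2 * Real.pi * (Complex.I * (t / (2 * Real.pi))) * n) =
      (latGauss u n : ℂ) * Complex.exp (((n * t : ℝ) : ℂ) * Complex.I) := by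
    intro n
    rw [latGauss, Complex.ofReal_exp, ← Complex.exp_add]
    congr 1
    push_cast
    field_simp
  -- The theta formula yields `n - t/(2π)`, whereas `periodGauss` uses `t + 2πn`; the index is
  -- negated here and restored by `Equiv.neg`.
  have h2 : ∀ n : ℤ, Complex.exp (-Real.pi / ((u / Real.pi : ℝ) : ℂ) *
      (n + Complex.I * (Complex.I * (t / (2 * Real.pi)))) ^ 2) =
      ((Real.exp (-((t + 2 * Real.pi * ((-n : ℤ) : ℝ)) ^ 2 / (4 * u))) : ℝ) : ℂ) := by
    intro n
    rw [Complex.ofReal_exp, ← mul_assoc, Complex.I_mul_I]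
    congr 1
    push_cast
    field_simp
    ring
  have h3 : 1 / ((u / Real.pi : ℝ) : ℂ) ^ (1 / 2 : ℂ) = ((√(Real.pi / u) : ℝ) : ℂ) := by
    rw [show (1 / 2 : ℂ) = ((1 / 2 : ℝ) : ℂ) by push_cast; rfl,
      ← Complex.ofReal_cpow (by positivity), ← Real.sqrt_eq_rpow, one_div, ← Complex.ofReal_inv,
      ← Real.sqrt_inv, inv_div]
  rw [tsum_congr h1, tsum_congr h2, h3] at h
  convert (summable_latGauss_mul_exp hu t).hasSum using 1
  rw [h, periodGauss, tsum_mul_left, Complex.ofReal_mul, Complex.ofReal_tsum,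
    ← (Equiv.neg ℤ).tsum_eq]
  rfl

/-- Translating by `k` multiplies the transform by `e^(-ikt)`, so the four terms of `lagKernel`
factor into two difference symbols. -/
lemma kernelFourier_eq {u : ℝ} (hu : 0 < u) (r s : ℤ) (t : ℝ) :
    kernelFourier r s u t = (1 - Complex.exp (((-(r * t) : ℝ) : ℂ) * Complex.I)) *
      (1 - Complex.exp (((s * t : ℝ) : ℂ) * Complex.I)) * periodGauss u t := by
  have h0 := hasSum_latGauss_mul_exp hu t
  have hshift : ∀ k : ℤ, HasSum
      (fun x : ℤ => (latGauss u (x + k) : ℂ) * Complex.exp (((x * t : ℝ) : ℂ) * Complex.I))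
      (Complex.exp (((-(k * t) : ℝ) : ℂ) * Complex.I) * periodGauss u t) := by
    intro k
    have h1 := ((Equiv.addRight k).hasSum_iff (f := fun x : ℤ =>
      (latGauss u x : ℂ) * Complex.exp (((x * t : ℝ) : ℂ) * Complex.I))).2 h0
    refine (h1.mul_left (Complex.exp (((-(k * t) : ℝ) : ℂ) * Complex.I))).congr_fun fun x => ?_
    simp only [Function.comp_apply, Equiv.coe_addRight]
    rw [mul_left_comm, ← Complex.exp_add]
    congr 2
    push_cast
    ring
  refine ((((h0.sub (hshift r)).sub (hshift (-s))).add (hshift (r - s))).congr_fun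
    fun x => ?_).tsum_eq.trans ?_
  · simp only [lagKernel]
    rw [← sub_eq_add_neg, ← add_sub_assoc]
    push_cast
    ring
  · have h3 : Complex.exp (((-((r - s : ℤ) * t) : ℝ) : ℂ) * Complex.I) =
      Complex.exp (((-(r * t) : ℝ) : ℂ) * Complex.I) *
        Complex.exp (((s * t : ℝ) : ℂ) * Complex.I) := by
      rw [← Complex.exp_add]
      congr 1
      push_cast
      ring
    have h4 : Complex.exp (((-((-s : ℤ) * t) : ℝ) : ℂ) * Complex.I) =
        Complex.exp (((s * t : ℝ) : ℂ) * Complex.I) := by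
      congr 1
      push_cast
      ring
    rw [h3, h4]
    ring

end PowerLawIRF

/-! ### Identification with the aliased spectral density. -/

namespace PowerLawIRF

open Set

/-- The squared norm of the symbol of the bilinear difference at step `r`. -/
lemma norm_kernelFourier {u : ℝ} (hu : 0 < u) (r s : ℤ) (t : ℝ) :
    ‖kernelFourier r s u t‖ = ‖1 - Complex.exp (((r * t : ℝ) : ℂ) * Complex.I)‖ *
      ‖1 - Complex.exp (((s * t : ℝ) : ℂ) * Complex.I)‖ * periodGauss u t := by
  have h1 : 1 - Complex.exp (((-(r * t) : ℝ) : ℂ) * Complex.I) =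
      (starRingEnd ℂ) (1 - Complex.exp (((r * t : ℝ) : ℂ) * Complex.I)) := by
    rw [map_sub, map_one, ← Complex.exp_conj, map_mul, Complex.conj_ofReal, Complex.conj_I]
    push_cast
    ring_nf
  rw [kernelFourier_eq hu, norm_mul, norm_mul, h1, Complex.norm_conj, Complex.norm_real,
    Real.norm_eq_abs, abs_of_nonneg (periodGauss_nonneg u t)]

lemma norm_kernelFourier_le {u : ℝ} (r s : ℤ) (h : Summable fun x => |lagKernel r s u x|)
    (t : ℝ) : ‖kernelFourier r s u t‖ ≤ ∑' x, |lagKernel r s u x| := by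
  have hn : ∀ x : ℤ, ‖(lagKernel r s u x : ℂ) * Complex.exp (((x * t : ℝ) : ℂ) * Complex.I)‖ =
      |lagKernel r s u x| := by
    intro x
    rw [norm_mul, Complex.norm_exp_ofReal_mul_I, mul_one, Complex.norm_real, Real.norm_eq_abs]
  have := norm_tsum_le_tsum_norm (h.congr fun x => (hn x).symm)
  rwa [tsum_congr hn] at this

lemma norm_symbolOne (l : Plane) :
    ‖symbolOne l‖ = ‖1 - Complex.exp (((l 0 : ℝ) : ℂ) * Complex.I)‖ *
      ‖1 - Complex.exp (((l 1 : ℝ) : ℂ) * Complex.I)‖ := by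
  rw [symbolOne, norm_mul, mul_comm Complex.I, mul_comm Complex.I]

lemma norm_one_sub_exp_two_mul_sq (t : ℝ) :
    ‖1 - Complex.exp (((2 * t : ℝ) : ℂ) * Complex.I)‖ ^ 2 =
      4 * Real.cos (t / 2) ^ 2 * ‖1 - Complex.exp (((t : ℝ) : ℂ) * Complex.I)‖ ^ 2 := by
  have h1 : ∀ z : ℂ, 1 - z ^ 2 = (1 + z) * (1 - z) := fun z => by ring
  have h2 : Complex.exp (((2 * t : ℝ) : ℂ) * Complex.I) =
      Complex.exp (((t : ℝ) : ℂ) * Complex.I) ^ 2 := by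
    rw [← Complex.exp_nat_mul]
    push_cast
    ring_nf
  have h3 : ‖1 + Complex.exp (((t : ℝ) : ℂ) * Complex.I)‖ ^ 2 = 4 * Real.cos (t / 2) ^ 2 := by
    have hc : Real.cos t = 2 * Real.cos (t / 2) ^ 2 - 1 := by
      rw [← Real.cos_two_mul]; ring_nf
    rw [← Complex.normSq_eq_norm_sq, Complex.normSq_apply, Complex.add_re, Complex.add_im,
      Complex.exp_ofReal_mul_I_re, Complex.exp_ofReal_mul_I_im, Complex.one_re, Complex.one_im]
    nlinarith [Real.sin_sq_add_cos_sq t]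
  rw [h2, h1, norm_mul, mul_pow, h3]

/-- This explains `b₂`: since `1 - z² = (1+z)(1-z)` and `|1+e^(it)|² = 4cos²(t/2)`, the factor `b_j`
turns the squared symbol at step `1` into the one at step `j`. The index `j` here starts at `0`. -/
lemma formSymbol_mul_norm_symbolOne_sq (l : Plane) (j : Fin 2) :
    formSymbol l j * ‖symbolOne l‖ ^ 2 =
      ‖1 - Complex.exp (((((j : ℕ) + 1 : ℕ) : ℤ) * l 0 : ℝ) * Complex.I)‖ ^ 2 *
      ‖1 - Complex.exp (((((j : ℕ) + 1 : ℕ) : ℤ) * l 1 : ℝ) * Complex.I)‖ ^ 2 := by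
  rw [norm_symbolOne, mul_pow]
  fin_cases j
  · simp [formSymbol]
  · have h0 := norm_one_sub_exp_two_mul_sq (l 0)
    have h1 := norm_one_sub_exp_two_mul_sq (l 1)
    simp only [formSymbol, Fin.mk_one, Matrix.cons_val_one, Matrix.cons_val_zero,
      Nat.reduceAdd, Nat.cast_ofNat, Int.cast_ofNat] at h0 h1 ⊢
    rw [h0, h1]
    ring

/-- The shift by `2π m`. -/
lemma add_shift_ne_zero {l : Plane} (hl : symbolOne l ≠ 0) (m : ℤ × ℤ) :
    l + !₂[2 * Real.pi * (m.1 : ℝ), 2 * Real.pi * (m.2 : ℝ)] ≠ 0 := by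
  intro h
  apply hl
  have h0 : l 0 = -(2 * Real.pi * m.1) := by
    have := congrArg (fun v : Plane => v 0) h
    simp at this
    linarith
  have : Complex.exp (Complex.I * (l 0 : ℂ)) = 1 := by
    rw [Complex.exp_eq_one_iff]
    refine ⟨-m.1, ?_⟩
    rw [h0]
    push_cast
    ring
  rw [symbolOne, this, sub_self, zero_mul]

lemma norm_sq_add_shift (l : Plane) (m : ℤ × ℤ) :
    ‖l + !₂[2 * Real.pi * (m.1 : ℝ), 2 * Real.pi * (m.2 : ℝ)]‖ ^ 2 =
      (l 0 + 2 * Real.pi * m.1) ^ 2 + (l 1 + 2 * Real.pi * m.2) ^ 2 := by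
  rw [EuclideanSpace.real_norm_sq_eq, Fin.sum_univ_two]
  simp

lemma hasSum_periodGauss_mul {u : ℝ} (hu : 0 < u) (l : Plane) :
    HasSum (fun m : ℤ × ℤ => Real.pi / u * Real.exp (-(‖l + !₂[2 * Real.pi * (m.1 : ℝ),
      2 * Real.pi * (m.2 : ℝ)]‖ ^ 2 / 4 / u))) (periodGauss u (l 0) * periodGauss u (l 1)) := by
  have h0 := summable_periodGauss hu (l 0)
  have h1 := summable_periodGauss hu (l 1)
  have h := h0.mul_of_nonneg h1 (fun _ => by positivity) (fun _ => by positivity)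
  have h2 := h.hasSum
  rw [← h0.tsum_mul_tsum h1 h] at h2
  refine h2.congr_fun fun m => ?_
  rw [norm_sq_add_shift, mul_mul_mul_comm, Real.mul_self_sqrt (by positivity), ← Real.exp_add]
  congr 2
  field_simp
  ring

/-- The constant of `f₀` comes from `π Γ(1+φ₂) (‖v‖²/4)^(-(1+φ₂))`. -/
lemma specDensity_eq_integral {φ₁ φ₂ : ℝ} (hp : 0 < φ₂) {v : Plane} (hv : v ≠ 0) :
    specDensity φ₁ φ₂ v = φ₁ * ∫ u in Ioi (0 : ℝ), Real.pi *
      (u ^ (-φ₂ - 2) * Real.exp (-(‖v‖ ^ 2 / 4 / u))) := by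
  have hn : 0 < ‖v‖ := norm_pos_iff.2 hv
  rw [integral_const_mul, integral_rpow_mul_exp_neg_div hp (by positivity), specDensity,
    Real.div_rpow (by positivity) (by norm_num), ← Real.rpow_natCast, ← Real.rpow_mul hn.le,
    show (4 : ℝ) = 2 ^ (2 : ℝ) by norm_num, ← Real.rpow_mul (by norm_num),
    show (2 : ℝ) * -(1 + φ₂) = -(2 + 2 * φ₂) by ring, Real.rpow_neg (by norm_num : (0 : ℝ) ≤ 2),
    div_inv_eq_mul]
  push_cast
  rw [show (2 : ℝ) * -(1 + φ₂) = -(2 + 2 * φ₂) by ring]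
  ring

/-- The aliased spectral density as a Gaussian mixture of periodised Gaussians. -/
lemma hasSum_specDensity (φ₁ : ℝ) {φ₂ : ℝ} (hp : 0 < φ₂) (hp1 : φ₂ < 1) {l : Plane}
    (hl : symbolOne l ≠ 0) :
    HasSum (fun m : ℤ × ℤ => specDensity φ₁ φ₂
      (l + !₂[2 * Real.pi * (m.1 : ℝ), 2 * Real.pi * (m.2 : ℝ)]))
      (φ₁ * ∫ u in Ioi (0 : ℝ), u ^ (-φ₂ - 1) * (periodGauss u (l 0) * periodGauss u (l 1))) := by
  set F : ℤ × ℤ → ℝ → ℝ := fun m u => Real.pi * (u ^ (-φ₂ - 2) * Real.exp (-(‖l +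
    !₂[2 * Real.pi * (m.1 : ℝ), 2 * Real.pi * (m.2 : ℝ)]‖ ^ 2 / 4 / u))) with hF
  have hint : ∀ m, IntegrableOn (F m) (Ioi 0) := fun m =>
    (integrableOn_rpow_mul_exp_neg_div hp
      (by have := norm_pos_iff.2 (add_shift_ne_zero hl m); positivity)).const_mul _
  have hnn : ∀ m u, 0 < u → 0 ≤ F m u := fun m u hu => by
    have := Real.rpow_nonneg hu.le (-φ₂ - 2)
    have := Real.pi_pos
    simp only [F]
    positivity
  have hFsum : ∀ u, 0 < u → HasSum (fun m => F m u)
      (u ^ (-φ₂ - 1) * (periodGauss u (l 0) * periodGauss u (l 1))) := by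
    intro u hu
    refine ((hasSum_periodGauss_mul hu l).mul_left (u ^ (-φ₂ - 1))).congr_fun fun m => ?_
    simp only [F]
    rw [show -φ₂ - 2 = -φ₂ - 1 - 1 by ring, Real.rpow_sub_one hu.ne' (-φ₂ - 1)]
    field_simp
  obtain ⟨C, hC⟩ := exists_sum_abs_lagKernel_mul_le 1 1
  have hpos : 0 < ‖symbolOne l‖ := norm_pos_iff.2 hl
  -- Multiplied by `|g|²`, the left side is a product of two values `‖kernelFourier 1 1 u ·‖`, each
  -- at most the `ℓ¹` norm of the kernel. Since `g(λ) ≠ 0`, the bound can be divided by `|g|²`.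
  have hbound : ∀ u, 0 < u → periodGauss u (l 0) * periodGauss u (l 1) ≤
      C / ‖symbolOne l‖ ^ 2 * min u 1 := by
    intro u hu
    obtain ⟨h1, -, h3⟩ := hC u hu
    have h4 := mul_le_mul (norm_kernelFourier_le (1 : ℕ) (1 : ℕ) h1 (l 0))
      (norm_kernelFourier_le (1 : ℕ) (1 : ℕ) h1 (l 1)) (norm_nonneg _)
      (tsum_nonneg fun _ => abs_nonneg _)
    rw [norm_kernelFourier hu, norm_kernelFourier hu] at h4
    have h5 := h4.trans ((sq _).symm.trans_le h3)
    rw [div_mul_eq_mul_div, le_div_iff₀ (by positivity), norm_symbolOne]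
    simp only [Nat.cast_one, Int.cast_one, one_mul] at h5
    linarith
  have hsum : Summable fun m => ∫ u in Ioi (0 : ℝ), ‖F m u‖ := by
    refine summable_of_sum_le
      (c := ∫ u in Ioi (0 : ℝ), C / ‖symbolOne l‖ ^ 2 * (u ^ (-φ₂ - 1) * min u 1))
      (fun m => integral_nonneg fun u => norm_nonneg _) fun S => ?_
    rw [← integral_finsetSum _ fun m _ => (hint m).norm]
    refine setIntegral_mono_on (integrable_finsetSum _ fun m _ => (hint m).norm)
      ((integrableOn_rpow_mul_min hp hp1).const_mul _) measurableSet_Ioi fun u hu => ?_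
    have hu0 : 0 ≤ u ^ (-φ₂ - 1) := Real.rpow_nonneg (le_of_lt hu) _
    calc ∑ m ∈ S, ‖F m u‖ = ∑ m ∈ S, F m u :=
          Finset.sum_congr rfl fun m _ => Real.norm_of_nonneg (hnn m u hu)
      _ ≤ u ^ (-φ₂ - 1) * (periodGauss u (l 0) * periodGauss u (l 1)) :=
          sum_le_hasSum S (fun m _ => hnn m u hu) (hFsum u hu)
      _ ≤ u ^ (-φ₂ - 1) * (C / ‖symbolOne l‖ ^ 2 * min u 1) := 
          mul_le_mul_of_nonneg_left (hbound u hu) hu0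
      _ = C / ‖symbolOne l‖ ^ 2 * (u ^ (-φ₂ - 1) * min u 1) := by ring
  have key := (hasSum_integral_of_summable_integral_norm hint hsum).mul_left φ₁
  rw [setIntegral_congr_fun measurableSet_Ioi fun u hu => (hFsum u hu).tsum_eq] at key
  exact key.congr_fun fun m => specDensity_eq_integral hp (add_shift_ne_zero hl m)

/-- For unequal steps the Fourier series carries the phase of `(1-e^(-irt))(1-e^(ist))` in each
coordinate; only its squared modulus is a function of `b_j`, `b_k` and `f`, and that is all Parseval
needs. -/
lemma norm_tsum_lagCov_sq (φ₁ : ℝ) {φ₂ : ℝ} (hp : 0 < φ₂) (hp1 : φ₂ < 1) {l : Plane}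
    (hl : symbolOne l ≠ 0) (j k : Fin 2) :
    ‖∑' h, (lagCov φ₁ φ₂ ((j : ℕ) + 1 : ℕ) ((k : ℕ) + 1 : ℕ) h : ℂ) * latChar l h‖ ^ 2 =
      formSymbol l j * formSymbol l k * diffDensity φ₁ φ₂ l ^ 2 := by
  rw [(hasSum_lagCov_mul_latChar φ₁ hp hp1 _ _ l).tsum_eq, diffDensity, latticeDensity,
    (hasSum_specDensity φ₁ hp hp1 hl).tsum_eq]
  have h1 : ∫ u in Ioi (0 : ℝ), ((u ^ (-φ₂ - 1) : ℝ) : ℂ) *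
      (kernelFourier ((j : ℕ) + 1 : ℕ) ((k : ℕ) + 1 : ℕ) u (l 0) *
        kernelFourier ((j : ℕ) + 1 : ℕ) ((k : ℕ) + 1 : ℕ) u (l 1)) =
      ((1 - Complex.exp (((-((((j : ℕ) + 1 : ℕ) : ℤ) * l 0) : ℝ) : ℂ) * Complex.I)) *
      (1 - Complex.exp ((((((k : ℕ) + 1 : ℕ) : ℤ) * l 0 : ℝ) : ℂ) * Complex.I))) *
      ((1 - Complex.exp (((-((((j : ℕ) + 1 : ℕ) : ℤ) * l 1) : ℝ) : ℂ) * Complex.I)) *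
      (1 - Complex.exp ((((((k : ℕ) + 1 : ℕ) : ℤ) * l 1 : ℝ) : ℂ) * Complex.I))) *
      ((∫ u in Ioi (0 : ℝ), u ^ (-φ₂ - 1) * (periodGauss u (l 0) * periodGauss u (l 1)) : ℝ) : ℂ)
      := by
    rw [← integral_complex_ofReal, ← integral_const_mul]
    refine setIntegral_congr_fun measurableSet_Ioi fun u hu => ?_
    simp only
    rw [kernelFourier_eq hu, kernelFourier_eq hu]
    push_cast
    ring
  have hconj : ∀ a : ℝ, ‖1 - Complex.exp (((-a : ℝ) : ℂ) * Complex.I)‖ =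
      ‖1 - Complex.exp ((a : ℂ) * Complex.I)‖ := by
    intro a
    rw [← Complex.norm_conj, map_sub, map_one, ← Complex.exp_conj, map_mul, Complex.conj_ofReal,
      Complex.conj_I]
    push_cast
    ring_nf
  rw [h1]
  simp only [norm_mul, hconj, Complex.norm_real, Real.norm_eq_abs, mul_pow, sq_abs]
  have hj := formSymbol_mul_norm_symbolOne_sq l j
  have hk := formSymbol_mul_norm_symbolOne_sq l k
  generalize (∫ u in Ioi (0 : ℝ), u ^ (-φ₂ - 1) * (periodGauss u (l 0) * periodGauss u (l 1))) = I
  linear_combination (-φ₁ ^ 2 * I ^ 2) * (hk *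
    (formSymbol l j * ‖symbolOne l‖ ^ 2)) + (-φ₁ ^ 2 * I ^ 2) * (hj * (‖1 - Complex.exp
      (((((k : ℕ) + 1 : ℕ) : ℤ) * l 0 : ℝ) * Complex.I)‖ ^ 2 *
      ‖1 - Complex.exp (((((k : ℕ) + 1 : ℕ) : ℤ) * l 1 : ℝ) * Complex.I)‖ ^ 2))

lemma measurableSet_torus : MeasurableSet torus := by
  have : torus = ⋂ i, (fun l : Plane => l i) ⁻¹' Ioc (-Real.pi) Real.pi := by
    ext l; simp [torus]
  rw [this]
  exact MeasurableSet.iInter fun i => (by fun_prop : Measurable fun l : Plane => l i)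
    measurableSet_Ioc

lemma ae_coord_ne_zero (i : Fin 2) : ∀ᵐ l : Plane, l i ≠ 0 := by
  have h : (volume : Measure Plane) (LinearMap.ker
      (EuclideanSpace.proj i : Plane →L[ℝ] ℝ).toLinearMap : Submodule ℝ Plane) = 0 := by
    refine Measure.addHaar_submodule _ _ fun htop => ?_
    have : EuclideanSpace.single i (1 : ℝ) ∈ LinearMap.ker
      (EuclideanSpace.proj i : Plane →L[ℝ] ℝ).toLinearMap := htop ▸ Submodule.mem_top
    simp at this
  rw [ae_iff]
  convert h using 2
  ext l
  simp

lemma one_sub_exp_ne_zero {t : ℝ} (ht : t ∈ Ioc (-Real.pi) Real.pi) (h0 : t ≠ 0) :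
    1 - Complex.exp (Complex.I * (t : ℂ)) ≠ 0 := by
  intro h
  have h1 : Complex.exp ((t : ℂ) * Complex.I) = 1 := by
    rw [mul_comm]; exact (sub_eq_zero.1 h).symm
  have h2 := congrArg Complex.arg h1
  rw [Complex.arg_exp_mul_I, Complex.arg_one,
    (toIocMod_eq_self Real.two_pi_pos).2 (by constructor <;> linarith [ht.1, ht.2])] at h2
  exact h0 h2

/-- On the torus the symbol vanishes only on the coordinate axes, a null set containing the
singularity of `f₀` at the origin. -/
lemma ae_symbolOne_ne_zero : ∀ᵐ l ∂torusMeasure, symbolOne l ≠ 0 := by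
  refine Measure.ae_smul_measure ?_ _
  filter_upwards [ae_restrict_mem measurableSet_torus, ae_restrict_of_ae (ae_coord_ne_zero 0),
    ae_restrict_of_ae (ae_coord_ne_zero 1)] with l hl h0 h1
  exact mul_ne_zero (one_sub_exp_ne_zero (hl 0) h0) (one_sub_exp_ne_zero (hl 1) h1)

end PowerLawIRF

/-! ### Parseval on the torus and the matrix `Σ`. -/

namespace PowerLawIRF

open Set

lemma measurePreserving_coords :
    MeasurePreserving (fun l : Plane => (l 0, l 1)) volume volume :=
  (volume_preserving_finTwoArrow ℝ).comp (EuclideanSpace.volume_preserving_symm_measurableEquiv_toLp (Fin 2))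

lemma measurableEmbedding_coords : MeasurableEmbedding (fun l : Plane => (l 0, l 1)) :=
  (MeasurableEquiv.finTwoArrow (α := ℝ)).measurableEmbedding.comp
    (MeasurableEquiv.toLp 2 (Fin 2 → ℝ)).symm.measurableEmbedding

lemma torus_eq_preimage : torus = (fun l : Plane => (l 0, l 1)) ⁻¹'
    (Ioc (-Real.pi) Real.pi ×ˢ Ioc (-Real.pi) Real.pi) := by
  ext l
  simp only [torus, mem_ofPred_eq, Fin.forall_fin_two, mem_preimage, mem_prod]

lemma integral_torusMeasure_mul (f g : ℝ → ℂ) :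
    ∫ l, f (l 0) * g (l 1) ∂torusMeasure = ((2 * Real.pi) ^ 2)⁻¹ •
      ((∫ t in Ioc (-Real.pi) Real.pi, f t) * ∫ t in Ioc (-Real.pi) Real.pi, g t) := by
  rw [torusMeasure, integral_smul_measure, ENNReal.toReal_ofReal (by positivity),
    torus_eq_preimage, ← setIntegral_prod_mul, ← Measure.volume_eq_prod]
  congr 1
  exact measurePreserving_coords.setIntegral_preimage_emb measurableEmbedding_coords
    (fun z : ℝ × ℝ => f z.1 * g z.2) _

lemma volume_torus : volume torus = ENNReal.ofReal ((2 * Real.pi) ^ 2) := by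
  rw [torus_eq_preimage, measurePreserving_coords.measure_preimage_emb measurableEmbedding_coords,
    Measure.volume_eq_prod, Measure.prod_prod, Real.volume_Ioc, ← ENNReal.ofReal_mul (by
      linarith [Real.pi_pos])]
  ring_nf

instance isProbabilityMeasure_torusMeasure : IsProbabilityMeasure torusMeasure := by
  constructor
  rw [torusMeasure, Measure.smul_apply, Measure.restrict_apply_univ, volume_torus, smul_eq_mul,
    ← ENNReal.ofReal_mul (by positivity), inv_mul_cancel₀ (by positivity), ENNReal.ofReal_one]

lemma integral_exp_int_mul (n : ℤ) :
    ∫ t in Ioc (-Real.pi) Real.pi, Complex.exp (((n * t : ℝ) : ℂ) * Complex.I) =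
      if n = 0 then ((2 * Real.pi : ℝ) : ℂ) else 0 := by
  rw [← intervalIntegral.integral_of_le (by linarith [Real.pi_pos])]
  split_ifs with h
  · subst h
    simp
    ring
  · have hc : (n : ℂ) * Complex.I ≠ 0 := mul_ne_zero (Int.cast_ne_zero.2 h) Complex.I_ne_zero
    have h1 : ∀ t : ℝ, Complex.exp (((n * t : ℝ) : ℂ) * Complex.I) =
        Complex.exp ((n : ℂ) * Complex.I * t) := by
      intro t; push_cast; ring_nf
    simp_rw [h1]
    rw [integral_exp_mul_complex hc, div_eq_zero_iff]
    left
    rw [sub_eq_zero, Complex.exp_eq_exp_iff_exists_int]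
    exact ⟨n, by push_cast; ring⟩

lemma latChar_mul_conj (l : Plane) (h k : ℤ × ℤ) :
    latChar l h * (starRingEnd ℂ) (latChar l k) = latChar l (h - k) := by
  rw [latChar, latChar, latChar, map_mul, ← Complex.exp_conj, ← Complex.exp_conj, map_mul, map_mul,
    Complex.conj_ofReal, Complex.conj_ofReal, Complex.conj_I]
  simp only [← Complex.exp_add]
  congr 1
  simp only [Prod.fst_sub, Prod.snd_sub]
  push_cast
  ring

lemma integral_latChar (h : ℤ × ℤ) :
    ∫ l, latChar l h ∂torusMeasure = if h = 0 then 1 else 0 := by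
  have := integral_torusMeasure_mul (fun t => Complex.exp (((h.1 * t : ℝ) : ℂ) * Complex.I))
    (fun t => Complex.exp (((h.2 * t : ℝ) : ℂ) * Complex.I))
  rw [integral_exp_int_mul, integral_exp_int_mul] at this
  simp only [latChar]
  rw [this]
  have hpi : (Real.pi : ℂ) ≠ 0 := Complex.ofReal_ne_zero.2 Real.pi_ne_zero
  by_cases h1 : h.1 = 0 <;> by_cases h2 : h.2 = 0 <;> simp [h1, h2, Prod.ext_iff]
  field_simp

lemma continuous_latChar (h : ℤ × ℤ) : Continuous fun l => latChar l h := by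
  unfold latChar
  fun_prop

lemma continuous_tsum_latChar {v : ℤ × ℤ → ℝ} (hv : Summable fun h => |v h|) :
    Continuous fun l => ∑' h, (v h : ℂ) * latChar l h := by
  refine continuous_tsum (fun h => (continuous_latChar h).const_mul _) hv fun h l => ?_
  rw [norm_mul, norm_latChar, mul_one, Complex.norm_real, Real.norm_eq_abs]

lemma norm_tsum_latChar_le {v : ℤ × ℤ → ℝ} (hv : Summable fun h => |v h|) (l : Plane) :
    ‖∑' h, (v h : ℂ) * latChar l h‖ ≤ ∑' h, |v h| := by
  have hn : ∀ h, ‖(v h : ℂ) * latChar l h‖ = |v h| := fun h => by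
    rw [norm_mul, norm_latChar, mul_one, Complex.norm_real, Real.norm_eq_abs]
  exact (norm_tsum_le_tsum_norm (hv.congr fun h => (hn h).symm)).trans_eq (tsum_congr hn)

lemma integral_tsum_latChar_mul {v : ℤ × ℤ → ℝ} (hv : Summable fun h => |v h|) {g : Plane → ℂ}
    (hg : Continuous g) {C : ℝ} (hC : ∀ l, ‖g l‖ ≤ C) :
    ∫ l, (∑' h, (v h : ℂ) * latChar l h) * g l ∂torusMeasure =
      ∑' h, (v h : ℂ) * ∫ l, latChar l h * g l ∂torusMeasure := by
  have hnorm : ∀ h l, ‖(v h : ℂ) * latChar l h * g l‖ ≤ |v h| * C := fun h l => by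
    rw [norm_mul, norm_mul, norm_latChar, mul_one, Complex.norm_real, Real.norm_eq_abs]
    gcongr
    exact hC l
  have hint : ∀ h, Integrable (fun l => (v h : ℂ) * latChar l h * g l) torusMeasure := fun h =>
    Integrable.of_bound (((continuous_latChar h).const_mul _).mul hg).aestronglyMeasurable
      (|v h| * C) (ae_of_all _ (hnorm h))
  have hsum : Summable fun h => ∫ l, ‖(v h : ℂ) * latChar l h * g l‖ ∂torusMeasure := by
    refine (hv.mul_right C).of_nonneg_of_le
      (fun h => integral_nonneg fun l => norm_nonneg _) fun h => ?_
    refine (integral_mono (hint h).norm (integrable_const _) (hnorm h)).trans_eq ?_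
    simp
  have key := integral_tsum_of_summable_integral_norm hint hsum
  simp_rw [← tsum_mul_right, ← integral_const_mul, ← mul_assoc]
  exact key.symm

/-- Parseval's identity for absolutely summable Fourier series on the torus. -/
lemma integral_norm_tsum_latChar_sq {v : ℤ × ℤ → ℝ} (hv : Summable fun h => |v h|) :
    ∫ l, ‖∑' h, (v h : ℂ) * latChar l h‖ ^ 2 ∂torusMeasure = ∑' h, v h ^ 2 := by
  have hcoef : ∀ k, ∫ l, latChar l k *
      (starRingEnd ℂ) (∑' h, (v h : ℂ) * latChar l h) ∂torusMeasure = v k := by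
    intro k
    have h1 : ∀ l, latChar l k * (starRingEnd ℂ) (∑' h, (v h : ℂ) * latChar l h) =
        (starRingEnd ℂ) ((∑' h, (v h : ℂ) * latChar l h) * (starRingEnd ℂ) (latChar l k)) := by
      intro l
      rw [map_mul, Complex.conj_conj, mul_comm]
    simp_rw [h1]
    rw [integral_conj, integral_tsum_latChar_mul hv
      (g := fun l => (starRingEnd ℂ) (latChar l k))
      (Complex.continuous_conj.comp (continuous_latChar k)) (C := 1)
      (fun l => by rw [Complex.norm_conj, norm_latChar])]
    simp_rw [latChar_mul_conj, integral_latChar, sub_eq_zero]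
    simp
  have key := integral_tsum_latChar_mul hv
    (Complex.continuous_conj.comp (continuous_tsum_latChar hv))
    (fun l => (Complex.norm_conj _).trans_le (norm_tsum_latChar_le hv l))
  simp only [Function.comp_apply] at key
  simp_rw [hcoef, Complex.mul_conj'] at key
  have h2 := integral_complex_ofReal (μ := torusMeasure)
    (f := fun l => ‖∑' h, (v h : ℂ) * latChar l h‖ ^ 2)
  push_cast at h2
  rw [h2] at key
  apply Complex.ofReal_injective
  rw [key, Complex.ofReal_tsum]
  push_cast
  exact tsum_congr fun h => (sq _).symm

/-- The bridge from the spectral definition of `Σ` to sums of squared covariances, in which form the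
limit of the variances is computed. -/
lemma sigmaMatrix_apply (φ₁ : ℝ) {φ₂ : ℝ} (hp : 0 < φ₂) (hp1 : φ₂ < 1) (j k : Fin 2) :
    sigmaMatrix φ₁ φ₂ j k =
      2 * ∑' h, lagCov φ₁ φ₂ ((j : ℕ) + 1 : ℕ) ((k : ℕ) + 1 : ℕ) h ^ 2 := by
  rw [← integral_norm_tsum_latChar_sq (summable_abs_lagCov φ₁ hp hp1 _ _), sigmaMatrix,
    Matrix.of_apply]
  congr 1
  refine integral_congr_ae ?_
  filter_upwards [ae_symbolOne_ne_zero] with l hl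
  exact (norm_tsum_lagCov_sq φ₁ hp hp1 hl j k).symm

lemma ae_summable_specDensity (φ₁ : ℝ) {φ₂ : ℝ} (hp : 0 < φ₂) (hp1 : φ₂ < 1) :
    ∀ᵐ l ∂torusMeasure, Summable fun m : ℤ × ℤ => specDensity φ₁ φ₂
      (l + !₂[2 * Real.pi * (m.1 : ℝ), 2 * Real.pi * (m.2 : ℝ)]) := by
  filter_upwards [ae_symbolOne_ne_zero] with l hl
  exact (hasSum_specDensity φ₁ hp hp1 hl).summable

lemma diffDensity_nonneg {φ₁ φ₂ : ℝ} (h₁ : 0 ≤ φ₁) (hp : 0 < φ₂) (l : Plane) :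
    0 ≤ diffDensity φ₁ φ₂ l := by
  have := Real.Gamma_pos_of_pos (by linarith : 0 < 1 + φ₂)
  exact mul_nonneg (by positivity) (tsum_nonneg fun m => by
    rw [specDensity]; positivity)

lemma diffDensity_ae_eq {φ₁ φ₂ : ℝ} (h₁ : 0 ≤ φ₁) (hp : 0 < φ₂) (hp1 : φ₂ < 1) :
    (fun l => ‖∑' h, (lagCov φ₁ φ₂ 1 1 h : ℂ) * latChar l h‖) =ᵐ[torusMeasure]
      diffDensity φ₁ φ₂ := by
  filter_upwards [ae_symbolOne_ne_zero] with l hl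
  have h := norm_tsum_lagCov_sq φ₁ hp hp1 hl 0 0
  simp only [formSymbol, Matrix.cons_val_zero, one_mul, Fin.val_zero, zero_add,
    Nat.cast_one] at h
  exact (sq_eq_sq₀ (norm_nonneg _) (diffDensity_nonneg h₁ hp l)).1 h

/-- Almost everywhere `f` is the modulus of an absolutely convergent Fourier series, so it is
essentially bounded. -/
lemma memLp_diffDensity {φ₁ φ₂ : ℝ} (h₁ : 0 ≤ φ₁) (hp : 0 < φ₂) (hp1 : φ₂ < 1)
    {q : ENNReal} : MemLp (diffDensity φ₁ φ₂) q torusMeasure := by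
  have hs := summable_abs_lagCov φ₁ hp hp1 1 1
  refine (MemLp.of_bound (continuous_tsum_latChar hs).norm.aestronglyMeasurable
    (∑' h, |lagCov φ₁ φ₂ 1 1 h|) (ae_of_all _ fun l => ?_)).ae_eq (diffDensity_ae_eq h₁ hp hp1)
  rw [norm_norm]
  exact norm_tsum_latChar_le hs l

end PowerLawIRF

/-! ### The characteristic function of the centred `χ²₁` law. -/

namespace PowerLawIRF

lemma integral_pow_four_gaussianReal : ∫ x, x ^ 4 ∂(gaussianReal 0 1) = 3 := by
  rw [integral_gaussianReal_eq_integral_smul one_ne_zero]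
  have h1 : ∀ x : ℝ, gaussianPDFReal 0 1 x • x ^ 4 = (√(2 * Real.pi))⁻¹ *
      ((fun y : ℝ => y ^ (4 : ℝ) * Real.exp (-(1 / 2) * y ^ (2 : ℝ))) |x|) := by
    intro x
    simp only [gaussianPDFReal, smul_eq_mul, sub_zero, NNReal.coe_one, mul_one]
    rw [show (4 : ℝ) = ((4 : ℕ) : ℝ) by norm_num, Real.rpow_natCast, Real.rpow_two, sq_abs,
      pow_abs, abs_of_nonneg (by positivity)]
    ring_nf
  simp_rw [h1]
  rw [integral_const_mul, integral_comp_abs (f := fun y : ℝ => y ^ (4 : ℝ) *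
      Real.exp (-(1 / 2) * y ^ (2 : ℝ))),
    integral_rpow_mul_exp_neg_mul_rpow (by norm_num) (by norm_num) (by norm_num)]
  have hG : Real.Gamma ((4 + 1) / 2) = 3 / 4 * √Real.pi := by
    rw [show ((4 : ℝ) + 1) / 2 = 1 / 2 + 1 + 1 by norm_num, Real.Gamma_add_one (by norm_num),
      Real.Gamma_add_one (by norm_num), Real.Gamma_one_half_eq]
    ring
  have hpow : ((1 : ℝ) / 2) ^ (-(4 + 1) / 2 : ℝ) = 4 * √2 := by
    rw [one_div, Real.inv_rpow (by norm_num), ← Real.rpow_neg (by norm_num),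
      show -(-((4 : ℝ) + 1) / 2) = 2 + 1 / 2 by norm_num, Real.rpow_add (by norm_num),
      ← Real.sqrt_eq_rpow]
    norm_num
  rw [hG, hpow, Real.sqrt_mul (by norm_num)]
  have : 0 < √Real.pi := Real.sqrt_pos.2 Real.pi_pos
  field_simp

lemma integral_sq_gaussianReal : ∫ x, x ^ 2 ∂(gaussianReal 0 1) = 1 := by
  have h := variance_eq_sub (memLp_id_gaussianReal' (μ := 0) (v := 1) 2 (by norm_num))
  rw [variance_id_gaussianReal] at h
  simpa using h.symm

lemma integrable_pow_gaussianReal (n : ℕ) : Integrable (fun x : ℝ => x ^ n) (gaussianReal 0 1) := by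
  rcases Nat.eq_zero_or_pos n with rfl | hn
  · simp
  · have h := (memLp_id_gaussianReal' (μ := 0) (v := 1) n (by simp)).integrable_norm_pow hn.ne'
    refine (integrable_norm_iff (by fun_prop)).1 (h.congr (ae_of_all _ fun x => ?_))
    simp

/-- The characteristic function of the centred `χ²₁` law. -/
noncomputable def chiSqCharFun (s : ℝ) : ℂ :=
  ∫ z, Complex.exp (((s * (z ^ 2 - 1) : ℝ) : ℂ) * Complex.I) ∂(gaussianReal 0 1)

lemma norm_chiSqCharFun_le (s : ℝ) : ‖chiSqCharFun s‖ ≤ 1 := by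
  refine (norm_integral_le_integral_norm _).trans_eq ?_
  simp_rw [Complex.norm_exp_ofReal_mul_I]
  simp

/-- The variable `(z²-1)/√2` has mean `0` and variance `1`; its second-order expansion at `√2 s` is
`1 - s² + o(s²)`, which is also that of `e^(-s²)`. The fourth Gaussian moment enters through the
variance. -/
lemma chiSqCharFun_sub_exp_isLittleO :
    ∀ ε > 0, ∃ δ > 0, ∀ s : ℝ, |s| ≤ δ →
      ‖chiSqCharFun s - Complex.exp ((-(s ^ 2) : ℝ) : ℂ)‖ ≤ ε * s ^ 2 := by
  intro ε hε
  set X : ℝ → ℝ := fun z => (z ^ 2 - 1) / √2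
  have h2 : (√2 : ℝ) ^ 2 = 2 := Real.sq_sqrt (by norm_num)
  have hX : AEMeasurable X (gaussianReal 0 1) := by fun_prop
  have h0 : (gaussianReal 0 1)[X] = 0 := by
    simp only [X]
    rw [integral_div, integral_sub (integrable_pow_gaussianReal 2) (integrable_const _),
      integral_sq_gaussianReal]
    simp
  have h1 : (gaussianReal 0 1)[X ^ 2] = 1 := by
    have : ∀ z, (X ^ 2) z = (z ^ 4 - 2 * z ^ 2 + 1) / 2 := by
      intro z
      simp only [X, Pi.pow_apply]
      rw [div_pow, h2]
      ring
    simp_rw [this]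
    rw [integral_div, integral_add (f := fun z : ℝ => z ^ 4 - 2 * z ^ 2) ((integrable_pow_gaussianReal 4).sub
      ((integrable_pow_gaussianReal 2).const_mul 2)) (integrable_const _),
      integral_sub (integrable_pow_gaussianReal 4) ((integrable_pow_gaussianReal 2).const_mul 2),
      integral_const_mul, integral_sq_gaussianReal, integral_pow_four_gaussianReal]
    simp
    norm_num
  have hT := taylor_charFun_two hX h0 h1
  have hlim : Tendsto (fun s : ℝ => √2 * s) (𝓝 0) (𝓝 0) := by
    have : Continuous fun s : ℝ => √2 * s := by fun_prop
    simpa using this.tendsto 0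
  have hT2 := hT.comp_tendsto hlim
  have hchar : ∀ s : ℝ, charFun ((gaussianReal 0 1).map X) (√2 * s) = chiSqCharFun s := by
    intro s
    rw [charFun_apply_real, integral_map hX (by fun_prop), chiSqCharFun]
    congr 1
    ext z
    simp only [X]
    congr 1
    push_cast
    field_simp
  have hE : (fun s : ℝ => Complex.exp ((-(s ^ 2) : ℝ) : ℂ) - (1 - (s : ℂ) ^ 2)) =o[𝓝 0]
      fun s : ℝ => s ^ 2 := by
    have hsq : Tendsto (fun s : ℝ => ((-(s ^ 2) : ℝ) : ℂ)) (𝓝 0) (𝓝 0) := by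
      have : Continuous fun s : ℝ => ((-(s ^ 2) : ℝ) : ℂ) := by fun_prop
      simpa using this.tendsto 0
    have hd := (hasDerivAt_iff_isLittleO.1 (Complex.hasDerivAt_exp 0)).comp_tendsto hsq
    refine (hd.congr_left fun s => ?_).trans_isBigO (Asymptotics.IsBigO.of_bound 1 ?_)
    · simp
      ring
    · refine Eventually.of_forall fun s => ?_
      simp
  have hψ : (fun s : ℝ => chiSqCharFun s - (1 - (s : ℂ) ^ 2)) =o[𝓝 0] fun s : ℝ => s ^ 2 := by
    refine (hT2.congr_left fun s => ?_).trans_isBigO (Asymptotics.IsBigO.of_bound 2 ?_)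
    · simp only [Function.comp_apply, hchar]
      rw [Complex.ofReal_mul, mul_pow, ← Complex.ofReal_pow, h2]
      push_cast
      ring
    · refine Eventually.of_forall fun s => ?_
      simp [mul_pow]
  have hfin := (hψ.sub hE).def hε
  obtain ⟨δ, hδ, hδ'⟩ := Metric.eventually_nhds_iff.1 hfin
  refine ⟨δ / 2, by positivity, fun s hs => ?_⟩
  have := hδ' (y := s) (by rw [Real.dist_eq, sub_zero]; linarith)
  simpa using this

/-- Lindeberg replacement: factors are exchanged one at a time, the others having modulus at most
`1`. -/
lemma norm_prod_sub_prod_le {κ : Type*} (s : Finset κ) (f g : κ → ℂ) (hf : ∀ i, ‖f i‖ ≤ 1)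
    (hg : ∀ i, ‖g i‖ ≤ 1) : ‖∏ i ∈ s, f i - ∏ i ∈ s, g i‖ ≤ ∑ i ∈ s, ‖f i - g i‖ := by
  classical
  induction s using Finset.induction_on with
  | empty => simp
  | insert a s ha ih =>
    rw [Finset.prod_insert ha, Finset.prod_insert ha, Finset.sum_insert ha]
    have hg' : ‖∏ i ∈ s, g i‖ ≤ 1 := by
      rw [norm_prod]
      exact Finset.prod_le_one (fun _ _ => norm_nonneg _) fun i _ => hg i
    calc ‖f a * ∏ i ∈ s, f i - g a * ∏ i ∈ s, g i‖
        = ‖f a * (∏ i ∈ s, f i - ∏ i ∈ s, g i) + (f a - g a) * ∏ i ∈ s, g i‖ := by ring_nf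
      _ ≤ ‖f a‖ * ‖∏ i ∈ s, f i - ∏ i ∈ s, g i‖ + ‖f a - g a‖ * ‖∏ i ∈ s, g i‖ := by
          rw [← norm_mul, ← norm_mul]; exact norm_add_le _ _
      _ ≤ 1 * (∑ i ∈ s, ‖f i - g i‖) + ‖f a - g a‖ * 1 := by gcongr; exact hf a
      _ = ‖f a - g a‖ + ∑ i ∈ s, ‖f i - g i‖ := by ring

end PowerLawIRF

/-! ### Central limit theorem for Gaussian quadratic forms. -/

namespace PowerLawIRF

open Matrix WithLp

/-- Schur test: `|z_i z_j| ≤ (z_i² + z_j²)/2`, and by symmetry both halves contribute equally. -/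
lemma dotProduct_mulVec_le {ι : Type*} [Fintype ι] {C : Matrix ι ι ℝ} (hC : C.IsHermitian) {R : ℝ}
    (hR : ∀ i, ∑ j, |C i j| ≤ R) (z : ι → ℝ) :
    z ⬝ᵥ C *ᵥ z ≤ R * ∑ i, z i ^ 2 := by
  have hsymm : ∀ i j, C i j = C j i := fun i j => by simpa using (hC.apply i j).symm
  have h1 : ∀ i j, z i * (C i j * z j) ≤ |C i j| * z i ^ 2 / 2 + |C j i| * z j ^ 2 / 2 := by
    intro i j
    rw [hsymm j i]
    have h2 : z i * (C i j * z j) ≤ |C i j| * (|z i| * |z j|) := by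
      refine (le_abs_self _).trans_eq ?_
      rw [abs_mul, abs_mul]
      ring
    have h3 : |z i| * |z j| ≤ (z i ^ 2 + z j ^ 2) / 2 := by
      nlinarith [sq_nonneg (|z i| - |z j|), sq_abs (z i), sq_abs (z j)]
    linarith [mul_le_mul_of_nonneg_left h3 (abs_nonneg (C i j))]
  have hb : ∑ i, ∑ j, |C i j| * z i ^ 2 ≤ R * ∑ i, z i ^ 2 := by
    rw [Finset.mul_sum]
    refine Finset.sum_le_sum fun i _ => ?_
    rw [← Finset.sum_mul]
    exact mul_le_mul_of_nonneg_right (hR i) (sq_nonneg _)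
  calc z ⬝ᵥ C *ᵥ z = ∑ i, ∑ j, z i * (C i j * z j) := by
        simp only [dotProduct, mulVec, Finset.mul_sum]
    _ ≤ ∑ i, ∑ j, (|C i j| * z i ^ 2 / 2 + |C j i| * z j ^ 2 / 2) :=
        Finset.sum_le_sum fun i _ => Finset.sum_le_sum fun j _ => h1 i j
    _ = ∑ i, ∑ j, |C i j| * z i ^ 2 := by
        simp_rw [Finset.sum_add_distrib]
        rw [Finset.sum_comm (f := fun i j => |C j i| * z j ^ 2 / 2), ← Finset.sum_add_distrib]
        simp_rw [← Finset.sum_add_distrib, add_halves]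
    _ ≤ _ := hb

section QuadraticForm

variable {ι : Type*} [Fintype ι] [DecidableEq ι]

lemma trace_mul_self_eq_sum_eigenvalues {M : Matrix ι ι ℝ} (hM : M.IsHermitian) :
    (M * M).trace = ∑ k, hM.eigenvalues k ^ 2 := by
  have h := congrArg (fun N => (N * N).trace) hM.spectral_theorem
  beta_reduce at h
  rw [← map_mul, diagonal_mul_diagonal, Unitary.conjStarAlgAut_apply] at h
  rw [h, Matrix.trace_mul_comm, ← mul_assoc, Unitary.coe_star_mul_self, one_mul,
    Matrix.trace_diagonal]
  simp [sq]

lemma quadForm_sum_eigenvectorBasis {M : Matrix ι ι ℝ} (hM : M.IsHermitian) (y : ι → ℝ) :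
    (∑ k, y k • hM.eigenvectorBasis k).ofLp ⬝ᵥ M *ᵥ (∑ k, y k • hM.eigenvectorBasis k).ofLp =
      ∑ k, hM.eigenvalues k * y k ^ 2 := by
  have h1 : M *ᵥ (∑ k, y k • hM.eigenvectorBasis k).ofLp =
      (∑ k, (hM.eigenvalues k * y k) • hM.eigenvectorBasis k).ofLp := by
    simp only [ofLp_sum, ofLp_smul, mulVec_sum, mulVec_smul, hM.mulVec_eigenvectorBasis, smul_smul]
    simp_rw [mul_comm]
  rw [h1, dotProduct_comm, ← star_trivial (∑ k, y k • hM.eigenvectorBasis k).ofLp,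
    ← EuclideanSpace.inner_eq_star_dotProduct, hM.eigenvectorBasis.orthonormal.inner_sum]
  refine Finset.sum_congr rfl fun k _ => ?_
  simp
  ring

lemma sum_mul_mulVec_sq {S : Matrix ι ι ℝ} (hS : Sᵀ = S) (a : ι → ℝ) (z : ι → ℝ) :
    ∑ i, a i * (S *ᵥ z) i ^ 2 = z ⬝ᵥ (S * diagonal a * S) *ᵥ z := by
  rw [← mulVec_mulVec, ← mulVec_mulVec, dotProduct_mulVec z S, ← mulVec_transpose, hS]
  simp only [dotProduct, mulVec_diagonal]
  exact Finset.sum_congr rfl fun i _ => by ring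

open scoped MatrixOrder in
/-- Diagonalisation of a quadratic form of a centred Gaussian vector. -/
lemma exists_diagonalization {C : Matrix ι ι ℝ} (hC : C.PosSemidef) (a : ι → ℝ) :
    ∃ lam : ι → ℝ,
      (∫ x, Complex.exp (((∑ i, a i * x i ^ 2 : ℝ) : ℂ) * Complex.I) ∂multivariateGaussian 0 C =
        ∏ k, ∫ z, Complex.exp (((lam k * z ^ 2 : ℝ) : ℂ) * Complex.I) ∂gaussianReal 0 1) ∧
      ∑ k, lam k = ∑ i, a i * C i i ∧
      ∑ k, lam k ^ 2 = ∑ i, ∑ j, a i * a j * C i j ^ 2 ∧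
      ∀ A R : ℝ, (∀ i, |a i| ≤ A) → (∀ i, ∑ j, |C i j| ≤ R) → ∀ k, |lam k| ≤ A * R := by
  set S := CFC.sqrt C with hSdef
  have hSS : S * S = C := CFC.sqrt_mul_sqrt_self C hC.nonneg
  have hSt : Sᵀ = S := by
    have h : IsSelfAdjoint S := (CFC.sqrt_nonneg C).isSelfAdjoint
    have h2 : Sᴴ = S := h.star_eq
    rwa [conjTranspose_eq_transpose_of_trivial] at h2
  -- For `x = Sz` with `z` standard Gaussian, `∑ a_i x_i² = zᵀMz`. The coordinates of `z` in an
  -- eigenbasis of `M` are again independent standard Gaussians, so the eigenvalues of `M` serve as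
  -- `lam`.
  set M := S * diagonal a * S
  have hM : M.IsHermitian := by
    rw [Matrix.IsHermitian, conjTranspose_eq_transpose_of_trivial]
    simp only [M, transpose_mul, diagonal_transpose, hSt, mul_assoc]
  have hsymm : ∀ i j, C i j = C j i := fun i j => by simpa using (hC.1.apply i j).symm
  refine ⟨hM.eigenvalues, ?_, ?_, ?_, ?_⟩
  · rw [multivariateGaussian, integral_map (by fun_prop) (by fun_prop),
      stdGaussian_eq_map_pi_orthonormalBasis hM.eigenvectorBasis,
      integral_map (Measurable.aemeasurable (by fun_prop))
        (Measurable.aestronglyMeasurable (by fun_prop)), ← integral_fintype_prod_eq_prod]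
    congr 1
    ext y
    rw [← Complex.exp_sum, ← Finset.sum_mul, ← Complex.ofReal_sum]
    congr 3
    simp only [zero_add, ofLp_toEuclideanCLM]
    rw [sum_mul_mulVec_sq hSt]
    exact quadForm_sum_eigenvectorBasis hM y
  · have h := hM.trace_eq_sum_eigenvalues
    simp only [RCLike.ofReal_real_eq_id, id_eq] at h
    rw [← h, Matrix.trace_mul_comm, ← mul_assoc, hSS, Matrix.trace]
    exact Finset.sum_congr rfl fun i _ => by
      rw [diag_apply, mul_diagonal, mul_comm]
  · rw [← trace_mul_self_eq_sum_eigenvalues hM]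
    have h1 : (M * M).trace = ((C * diagonal a) * (C * diagonal a)).trace := by
      have : M * M = S * (diagonal a * (S * S) * diagonal a * S) := by
        simp only [M, mul_assoc]
      rw [this, Matrix.trace_mul_comm, mul_assoc, hSS, mul_assoc, mul_assoc, Matrix.trace_mul_comm]
      simp only [mul_assoc]
    rw [h1, Matrix.trace]
    refine Finset.sum_congr rfl fun i _ => ?_
    rw [diag_apply, mul_apply]
    refine Finset.sum_congr rfl fun j _ => ?_
    rw [mul_diagonal, mul_diagonal, hsymm j i]
    ring
  · intro A R hA hR k
    -- Each eigenvalue is the value of the form at a unit eigenvector `e`, at most `A · eᵀCe ≤ A ·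
    -- R` in modulus.
    have hk := quadForm_sum_eigenvectorBasis hM (Pi.single k 1)
    have hb : ∑ j, (Pi.single k 1 : ι → ℝ) j • hM.eigenvectorBasis j = hM.eigenvectorBasis k := by
      rw [Finset.sum_eq_single k] <;> simp +contextual
    have hl : ∑ j, hM.eigenvalues j * (Pi.single k 1 : ι → ℝ) j ^ 2 = hM.eigenvalues k := by
      rw [Finset.sum_eq_single k] <;> simp +contextual
    rw [hb, hl, ← sum_mul_mulVec_sq hSt] at hk
    have hnorm : ∑ i, (hM.eigenvectorBasis k) i ^ 2 = 1 := by
      rw [← EuclideanSpace.real_norm_sq_eq, hM.eigenvectorBasis.norm_eq_one, one_pow]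
    have hq := sum_mul_mulVec_sq hSt (fun _ => (1 : ℝ)) (hM.eigenvectorBasis k).ofLp
    have hA0 : 0 ≤ A := (abs_nonneg _).trans (hA k)
    rw [← hk]
    calc |∑ i, a i * (S *ᵥ (hM.eigenvectorBasis k).ofLp) i ^ 2|
        ≤ ∑ i, |a i * (S *ᵥ (hM.eigenvectorBasis k).ofLp) i ^ 2| := Finset.abs_sum_le_sum_abs _ _
      _ ≤ ∑ i, A * (1 * (S *ᵥ (hM.eigenvectorBasis k).ofLp) i ^ 2) := by
          refine Finset.sum_le_sum fun i _ => ?_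
          rw [abs_mul, abs_sq, one_mul]
          exact mul_le_mul_of_nonneg_right (hA i) (sq_nonneg _)
      _ = A * ((hM.eigenvectorBasis k).ofLp ⬝ᵥ C *ᵥ (hM.eigenvectorBasis k).ofLp) := by
          rw [← Finset.mul_sum, hq, diagonal_one, mul_one, hSS]
      _ ≤ A * (R * 1) := by
          rw [← hnorm]
          exact mul_le_mul_of_nonneg_left (dotProduct_mulVec_le hC.1 hR _) hA0
      _ = A * R := by rw [mul_one]

/-- Quantitative central limit theorem for quadratic forms of Gaussian vectors. -/
lemma quadForm_charFun_bound {ε : ℝ} (hε : 0 < ε) : ∃ δ > 0, ∀ {ι : Type} [Fintype ι]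
    [DecidableEq ι] (C : Matrix ι ι ℝ) (_ : C.PosSemidef) (a : ι → ℝ) (A R : ℝ)
    (_ : ∀ i, |a i| ≤ A) (_ : ∀ i, ∑ j, |C i j| ≤ R) (_ : A * R ≤ δ),
    ‖∫ x, Complex.exp (((∑ i, a i * (x i ^ 2 - C i i) : ℝ) : ℂ) * Complex.I)
        ∂multivariateGaussian 0 C -
      Complex.exp ((-(∑ i, ∑ j, a i * a j * C i j ^ 2) : ℝ) : ℂ)‖ ≤
      ε * ∑ i, ∑ j, a i * a j * C i j ^ 2 := by
  -- `δ` comes from the one-dimensional expansion, hence does not depend on the dimension, which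
  -- grows with the grid.
  obtain ⟨δ, hδ, h⟩ := chiSqCharFun_sub_exp_isLittleO ε hε
  refine ⟨δ, hδ, fun {ι} _ _ C hC a A R hA hR hAR => ?_⟩
  obtain ⟨lam, h1, h2, h3, h4⟩ := exists_diagonalization hC a
  have hint : ∫ x, Complex.exp (((∑ i, a i * (x i ^ 2 - C i i) : ℝ) : ℂ) * Complex.I)
      ∂multivariateGaussian 0 C = ∏ k, chiSqCharFun (lam k) := by
    -- Because `∑ a_i C_ii = ∑ lam_k`, the centring splits into one term `-lam_k` for each `χ²₁`
    -- variable.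
    have e1 : ∀ x : EuclideanSpace ℝ ι,
        Complex.exp (((∑ i, a i * (x i ^ 2 - C i i) : ℝ) : ℂ) * Complex.I) =
        Complex.exp (-(((∑ k, lam k : ℝ) : ℂ) * Complex.I)) *
          Complex.exp (((∑ i, a i * x i ^ 2 : ℝ) : ℂ) * Complex.I) := by
      intro x
      rw [← Complex.exp_add, h2]
      congr 1
      simp_rw [mul_sub, Finset.sum_sub_distrib]
      push_cast
      ring
    simp_rw [e1]
    rw [integral_const_mul, h1, Complex.ofReal_sum, Finset.sum_mul, ← Finset.sum_neg_distrib,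
      Complex.exp_sum, ← Finset.prod_mul_distrib]
    refine Finset.prod_congr rfl fun k _ => ?_
    rw [chiSqCharFun, ← integral_const_mul]
    congr 1
    ext z
    rw [← Complex.exp_add]
    congr 1
    push_cast
    ring
  have hexp : Complex.exp ((-(∑ i, ∑ j, a i * a j * C i j ^ 2) : ℝ) : ℂ) =
      ∏ k, Complex.exp ((-(lam k ^ 2) : ℝ) : ℂ) := by
    rw [← h3, ← Complex.exp_sum, ← Finset.sum_neg_distrib, Complex.ofReal_sum]
  rw [hint, hexp, ← h3, Finset.mul_sum]
  refine (norm_prod_sub_prod_le _ _ _ (fun k => norm_chiSqCharFun_le _) fun k => ?_).trans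
    (Finset.sum_le_sum fun k _ => h _ ((h4 A R hA hR k).trans hAR))
  rw [← Complex.ofReal_exp, Complex.norm_real, Real.norm_eq_abs, abs_of_pos (Real.exp_pos _),
    Real.exp_le_one_iff]
  exact neg_nonpos.2 (sq_nonneg _)

end QuadraticForm

end PowerLawIRF

/-! ### Contrasts: joint Gaussian law and covariances. -/

namespace PowerLawIRF

open Set Matrix WithLp

/-- The bilinear form `∑ c(x) d(y) k(x - y)` on finitely supported measures. -/
noncomputable def kernelForm (k : Plane → ℝ) (c d : Plane →₀ ℝ) : ℝ :=
  Finsupp.linearCombination ℝ (fun x => Finsupp.linearCombination ℝ (fun y => k (x - y)) d) c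

/-- The total mass of a finitely supported measure. -/
noncomputable def mass (c : Plane →₀ ℝ) : ℝ := Finsupp.linearCombination ℝ (fun _ => (1 : ℝ)) c

/-- The linear combination `∑ c(x) X(x)`. -/
noncomputable def evalContrast {Ω : Type*} (X : Plane → Ω → ℝ) (c : Plane →₀ ℝ) (ω : Ω) : ℝ :=
  Finsupp.linearCombination ℝ (fun x => X x ω) c

lemma kernelForm_eq_sum (k : Plane → ℝ) (c d : Plane →₀ ℝ) :
    kernelForm k c d = ∑ x ∈ c.support, ∑ y ∈ d.support, c x * d y * k (x - y) := by
  simp only [kernelForm, Finsupp.linearCombination_apply, Finsupp.sum, smul_eq_mul,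
    Finset.mul_sum, mul_assoc]

lemma mass_eq_sum (c : Plane →₀ ℝ) : mass c = ∑ x ∈ c.support, c x := by
  simp [mass, Finsupp.linearCombination_apply, Finsupp.sum]

lemma evalContrast_eq_sum {Ω : Type*} (X : Plane → Ω → ℝ) (c : Plane →₀ ℝ) (ω : Ω) :
    evalContrast X c ω = ∑ x ∈ c.support, c x * X x ω := by
  simp [evalContrast, Finsupp.linearCombination_apply, Finsupp.sum]

lemma kernelForm_comm {k : Plane → ℝ} (hk : ∀ h, k (-h) = k h) (c d : Plane →₀ ℝ) :
    kernelForm k c d = kernelForm k d c := by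
  rw [kernelForm_eq_sum, kernelForm_eq_sum, Finset.sum_comm]
  refine Finset.sum_congr rfl fun y _ => Finset.sum_congr rfl fun x _ => ?_
  rw [← neg_sub y x, hk]
  ring

lemma kernelForm_sum_sum {ι : Type*} [Fintype ι] (k : Plane → ℝ) (c : ι → Plane →₀ ℝ)
    (θ : ι → ℝ) : kernelForm k (∑ i, θ i • c i) (∑ i, θ i • c i) =
      ∑ i, ∑ j, θ i * (kernelForm k (c i) (c j) * θ j) := by
  simp only [kernelForm, map_sum, map_smul, smul_eq_mul]
  refine Finset.sum_congr rfl fun i _ => ?_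
  rw [← Finset.mul_sum]
  congr 1
  simp only [Finsupp.linearCombination_apply, Finsupp.sum, smul_eq_mul, Finset.mul_sum,
    Finset.sum_mul]
  rw [Finset.sum_comm]
  refine Finset.sum_congr rfl fun j _ => Finset.sum_congr rfl fun x _ => ?_
  exact Finset.sum_congr rfl fun y _ => by ring

section Law

variable {Ω : Type*} [MeasurableSpace Ω] {P : Measure Ω} {φ₁ φ₂ : ℝ} {X : Plane → Ω → ℝ}

lemma IsPowerLawIRF.hasGaussianLaw_evalContrast (hX : IsPowerLawIRF P φ₁ φ₂ X) {c : Plane →₀ ℝ}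
    (hc : mass c = 0) : HasGaussianLaw (evalContrast X c) P := by
  rw [funext (evalContrast_eq_sum X c)]
  exact hX.gaussian _ _ ((mass_eq_sum c).symm.trans hc)

lemma IsPowerLawIRF.integral_evalContrast (hX : IsPowerLawIRF P φ₁ φ₂ X) {c : Plane →₀ ℝ}
    (hc : mass c = 0) : ∫ ω, evalContrast X c ω ∂P = 0 := by
  rw [funext (evalContrast_eq_sum X c)]
  exact hX.mean_zero _ _ ((mass_eq_sum c).symm.trans hc)

lemma IsPowerLawIRF.variance_evalContrast (hX : IsPowerLawIRF P φ₁ φ₂ X) {c : Plane →₀ ℝ}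
    (hc : mass c = 0) : Var[evalContrast X c; P] = kernelForm (genCov φ₁ φ₂) c c := by
  rw [funext (evalContrast_eq_sum X c), kernelForm_eq_sum]
  exact hX.variance_eq _ _ ((mass_eq_sum c).symm.trans hc)

lemma genCov_neg (h : Plane) : genCov φ₁ φ₂ (-h) = genCov φ₁ φ₂ h := by
  rw [genCov, genCov, norm_neg]

variable {ι : Type*} [Fintype ι] {c : ι → Plane →₀ ℝ}

/-- The covariance matrix of a finite family of contrasts. -/
noncomputable def contrastCov (φ₁ φ₂ : ℝ) (c : ι → Plane →₀ ℝ) : Matrix ι ι ℝ :=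
  Matrix.of fun i j => kernelForm (genCov φ₁ φ₂) (c i) (c j)

lemma mass_sum_smul (hc : ∀ i, mass (c i) = 0) (θ : ι → ℝ) : mass (∑ i, θ i • c i) = 0 := by
  simp only [mass, map_sum, map_smul] at hc ⊢
  simp [hc]

lemma dotProduct_contrastCov (θ : ι → ℝ) : θ ⬝ᵥ contrastCov φ₁ φ₂ c *ᵥ θ =
    kernelForm (genCov φ₁ φ₂) (∑ i, θ i • c i) (∑ i, θ i • c i) := by
  rw [kernelForm_sum_sum]
  simp only [dotProduct, mulVec, contrastCov, Matrix.of_apply, Finset.mul_sum]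

lemma IsPowerLawIRF.posSemidef_contrastCov (hX : IsPowerLawIRF P φ₁ φ₂ X)
    (hc : ∀ i, mass (c i) = 0) : (contrastCov φ₁ φ₂ c).PosSemidef := by
  refine Matrix.PosSemidef.of_dotProduct_mulVec_nonneg ?_ fun θ => ?_
  · ext i j
    simp only [conjTranspose_apply, contrastCov, Matrix.of_apply, star_trivial]
    exact kernelForm_comm genCov_neg _ _
  · rw [star_trivial, dotProduct_contrastCov, ← hX.variance_evalContrast (mass_sum_smul hc θ)]
    exact variance_nonneg _ _

lemma IsPowerLawIRF.aemeasurable_toLp (hX : IsPowerLawIRF P φ₁ φ₂ X) (hc : ∀ i, mass (c i) = 0) :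
    AEMeasurable (fun ω => toLp 2 fun i => evalContrast X (c i) ω) P :=
  (MeasurableEquiv.toLp 2 (ι → ℝ)).measurable.comp_aemeasurable
    (aemeasurable_pi_lambda _ fun i => (hX.hasGaussianLaw_evalContrast (hc i)).aemeasurable)

/-- Contrasts of a power-law IRF are jointly Gaussian. -/
lemma IsPowerLawIRF.map_toLp_evalContrast [DecidableEq ι] [IsProbabilityMeasure P] (hX : IsPowerLawIRF P φ₁ φ₂ X)
    (hc : ∀ i, mass (c i) = 0) :
    P.map (fun ω => toLp 2 fun i => evalContrast X (c i) ω) =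
      multivariateGaussian 0 (contrastCov φ₁ φ₂ c) := by
  have hm := hX.aemeasurable_toLp hc
  have := Measure.isProbabilityMeasure_map hm
  refine Measure.ext_of_charFun ?_
  ext θ
  rw [charFun_multivariateGaussian (hX.posSemidef_contrastCov hc), dotProduct_contrastCov,
    charFun_apply, integral_map hm (by fun_prop)]
  have hmass := mass_sum_smul hc θ.ofLp
  -- Cramér–Wold: pairing the vector with `θ` gives another contrast of mass zero, whose law is
  -- known from the definition of the field.
  have hinner : ∀ ω, inner ℝ (toLp 2 fun i => evalContrast X (c i) ω) θ =
      evalContrast X (∑ i, θ.ofLp i • c i) ω := by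
    intro ω
    rw [PiLp.inner_apply]
    simp only [evalContrast, map_sum, map_smul, smul_eq_mul]
    exact Finset.sum_congr rfl fun i _ => by simp
  simp_rw [hinner]
  have hg := hX.hasGaussianLaw_evalContrast hmass
  have h1 := charFun_gaussianReal (μ := 0)
    (v := (kernelForm (genCov φ₁ φ₂) (∑ i, θ.ofLp i • c i) (∑ i, θ.ofLp i • c i)).toNNReal) 1
  have hnn : 0 ≤ kernelForm (genCov φ₁ φ₂) (∑ i, θ.ofLp i • c i) (∑ i, θ.ofLp i • c i) := by
    rw [← hX.variance_evalContrast hmass]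
    exact variance_nonneg _ _
  rw [← hX.variance_evalContrast hmass, ← hX.integral_evalContrast hmass,
    ← hg.map_eq_gaussianReal, charFun_apply_real, integral_map hg.aemeasurable (by fun_prop),
    hX.integral_evalContrast hmass, hX.variance_evalContrast hmass,
    Real.coe_toNNReal _ hnn] at h1
  simpa using h1

end Law

/-- The bilinear difference at `t` as a finitely supported measure. -/
noncomputable def bilinContrast (r : ℕ) (t : ℕ × ℕ) : Plane →₀ ℝ :=
  Finsupp.single (site t.1 t.2) 1 - Finsupp.single (site (t.1 + r) t.2) 1 -
    Finsupp.single (site t.1 (t.2 + r)) 1 + Finsupp.single (site (t.1 + r) (t.2 + r)) 1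

lemma evalContrast_bilinContrast {Ω : Type*} (X : Plane → Ω → ℝ) (r : ℕ) (t : ℕ × ℕ) :
    evalContrast X (bilinContrast r t) = bilinDiff X r t := by
  ext ω
  simp [evalContrast, bilinContrast, bilinDiff, Finsupp.linearCombination_single]

lemma mass_bilinContrast (r : ℕ) (t : ℕ × ℕ) : mass (bilinContrast r t) = 0 := by
  simp [mass, bilinContrast, Finsupp.linearCombination_single]

/-- Gaussian mixture representation of the power-law covariance on contrasts. -/
lemma kernelForm_genCov_eq_integral {φ₁ φ₂ : ℝ} (hp : 0 < φ₂) (hp1 : φ₂ < 1) {c d : Plane →₀ ℝ}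
    (hc : mass c = 0) : kernelForm (genCov φ₁ φ₂) c d =
      φ₁ * ∫ u in Ioi (0 : ℝ), u ^ (-φ₂ - 1) *
        kernelForm (fun h => Real.exp (-(u * ‖h‖ ^ 2))) c d := by
  have hK : ∀ h : Plane, genCov φ₁ φ₂ h =
      φ₁ * ∫ u in Ioi (0 : ℝ), u ^ (-φ₂ - 1) * (Real.exp (-(u * ‖h‖ ^ 2)) - 1) := by
    intro h
    rw [integral_rpow_mul_exp_sub_one hp hp1 (sq_nonneg _), genCov, Real.rpow_mul (norm_nonneg _),
      Real.rpow_two, mul_assoc]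
  have hint : ∀ x y : Plane, IntegrableOn (fun u : ℝ => c x * d y * (u ^ (-φ₂ - 1) *
      (Real.exp (-(u * ‖x - y‖ ^ 2)) - 1))) (Ioi 0) := fun x y =>
    (integrableOn_rpow_mul_exp_sub_one hp hp1 (sq_nonneg _)).const_mul _
  have hform : ∀ u : ℝ, u ^ (-φ₂ - 1) * kernelForm (fun h => Real.exp (-(u * ‖h‖ ^ 2))) c d =
      ∑ x ∈ c.support, ∑ y ∈ d.support, c x * d y * (u ^ (-φ₂ - 1) *
      (Real.exp (-(u * ‖x - y‖ ^ 2)) - 1)) := by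
    intro u
    -- Subtracting `1` from the Gaussian kernel is free: the constant is annihilated as soon as `c`
    -- has mass zero.
    have hm : ∑ x ∈ c.support, ∑ y ∈ d.support, c x * d y * u ^ (-φ₂ - 1) = 0 := by
      simp_rw [mul_assoc, ← Finset.mul_sum]
      rw [← Finset.sum_mul, ← mass_eq_sum, hc, zero_mul]
    rw [kernelForm_eq_sum, ← sub_zero (u ^ (-φ₂ - 1) * _), ← hm, Finset.mul_sum,
      ← Finset.sum_sub_distrib]
    refine Finset.sum_congr rfl fun x _ => ?_
    rw [Finset.mul_sum, ← Finset.sum_sub_distrib]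
    exact Finset.sum_congr rfl fun y _ => by ring
  simp_rw [hform]
  rw [integral_finsetSum _ fun x _ => integrable_finsetSum _ fun y _ => hint x y, kernelForm_eq_sum,
    Finset.mul_sum]
  refine Finset.sum_congr rfl fun x _ => ?_
  rw [integral_finsetSum _ fun y _ => hint x y, Finset.mul_sum]
  refine Finset.sum_congr rfl fun y _ => ?_
  rw [integral_const_mul, hK]
  ring

lemma exp_norm_site_sub (u : ℝ) (a b a' b' : ℕ) :
    Real.exp (-(u * ‖site a b - site a' b'‖ ^ 2)) =
      latGauss u ((a : ℤ) - a') * latGauss u ((b : ℤ) - b') := by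
  rw [EuclideanSpace.real_norm_sq_eq, Fin.sum_univ_two, latGauss, latGauss, ← Real.exp_add]
  simp [site]
  ring

/-- A bilinear difference is a product of coordinate differences, and the Gaussian kernel factors
likewise, so each coordinate contributes one `lagKernel`. -/
lemma kernelForm_bilinContrast {φ₁ φ₂ : ℝ} (hp : 0 < φ₂) (hp1 : φ₂ < 1) (r s : ℕ)
    (t t' : ℕ × ℕ) : kernelForm (genCov φ₁ φ₂) (bilinContrast r t) (bilinContrast s t') =
      lagCov φ₁ φ₂ r s ((t.1 : ℤ) - t'.1, (t.2 : ℤ) - t'.2) := by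
  rw [kernelForm_genCov_eq_integral hp hp1 (mass_bilinContrast r t), lagCov]
  congr 2
  ext u
  congr 1
  simp only [kernelForm, bilinContrast, map_sub, map_add, Finsupp.linearCombination_single,
    one_smul, exp_norm_site_sub, lagKernel]
  push_cast
  have e1 : ∀ a b k l : ℤ, latGauss u (a + k - (b + l)) = latGauss u (a - b + k - l) :=
    fun a b k l => by congr 1; ring
  have e2 : ∀ a b k : ℤ, latGauss u (a + k - b) = latGauss u (a - b + k) := fun a b k => by
    congr 1; ring
  have e3 : ∀ a b l : ℤ, latGauss u (a - (b + l)) = latGauss u (a - b - l) := fun a b l => by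
    congr 1; ring
  simp only [e1, e2, e3]
  ring

end PowerLawIRF

/-! ### Moments of the quadratic variations, and counting pairs by difference. -/

namespace PowerLawIRF

open Set

section Moments

variable {Ω : Type*} [MeasurableSpace Ω] {P : Measure Ω} {φ₁ φ₂ : ℝ} {X : Plane → Ω → ℝ}

lemma IsPowerLawIRF.hasGaussianLaw_bilinDiff (hX : IsPowerLawIRF P φ₁ φ₂ X) (r : ℕ) (t : ℕ × ℕ) :
    HasGaussianLaw (bilinDiff X r t) P := by
  rw [← evalContrast_bilinContrast]
  exact hX.hasGaussianLaw_evalContrast (mass_bilinContrast r t)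

lemma IsPowerLawIRF.integrable_bilinDiff_sq (hX : IsPowerLawIRF P φ₁ φ₂ X) (r : ℕ) (t : ℕ × ℕ) :
    Integrable (fun ω => bilinDiff X r t ω ^ 2) P :=
  (hX.hasGaussianLaw_bilinDiff r t).memLp_two.integrable_sq

lemma IsPowerLawIRF.integral_bilinDiff_sq (hX : IsPowerLawIRF P φ₁ φ₂ X) (hp : 0 < φ₂)
    (hp1 : φ₂ < 1) (r : ℕ) (t : ℕ × ℕ) :
    ∫ ω, bilinDiff X r t ω ^ 2 ∂P = lagCov φ₁ φ₂ r r (0, 0) := by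
  have hm := mass_bilinContrast r t
  have h1 := hX.variance_evalContrast hm
  have h2 := hX.integral_evalContrast hm
  rw [evalContrast_bilinContrast] at h1 h2
  rw [variance_of_integral_eq_zero (hX.hasGaussianLaw_bilinDiff r t).aemeasurable h2,
    kernelForm_bilinContrast hp hp1] at h1
  simpa using h1

lemma IsPowerLawIRF.meanSq_eq (hX : IsPowerLawIRF P φ₁ φ₂ X) (hp : 0 < φ₂)
    (hp1 : φ₂ < 1) (r : ℕ) : meanSq P X r = lagCov φ₁ φ₂ r r (0, 0) :=
  hX.integral_bilinDiff_sq hp hp1 r (0, 0)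

lemma card_grid (k : ℕ) : ((grid k).card : ℝ) = (k : ℝ) ^ 2 := by
  rw [grid, Finset.card_product, Finset.card_range]
  push_cast
  ring

lemma IsPowerLawIRF.integrable_quadVar (hX : IsPowerLawIRF P φ₁ φ₂ X) (r n : ℕ) :
    Integrable (quadVar X r n) P :=
  (integrable_finsetSum _ fun t _ => hX.integrable_bilinDiff_sq r t).const_mul _

lemma IsPowerLawIRF.integral_quadVar (hX : IsPowerLawIRF P φ₁ φ₂ X) (hp : 0 < φ₂)
    (hp1 : φ₂ < 1) {r n : ℕ} (hn : 2 * r < n) : ∫ ω, quadVar X r n ω ∂P = meanSq P X r := by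
  have hc : ((grid (n - 2 * r)).card : ℝ) ≠ 0 := by
    rw [card_grid]
    have : n - 2 * r ≠ 0 := by omega
    positivity
  simp only [quadVar]
  rw [integral_const_mul, integral_finsetSum _ fun t _ => hX.integrable_bilinDiff_sq r t]
  simp_rw [hX.integral_bilinDiff_sq hp hp1]
  rw [Finset.sum_const, nsmul_eq_mul, inv_mul_cancel_left₀ hc, hX.meanSq_eq hp hp1]

lemma Gamma_neg_lt_zero {p : ℝ} (hp : 0 < p) (hp1 : p < 1) : Real.Gamma (-p) < 0 := by
  have h1 : Real.Gamma (1 - p) = -p * Real.Gamma (-p) := by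
    rw [← Real.Gamma_add_one (by linarith : -p ≠ 0)]; ring_nf
  have h2 := Real.Gamma_pos_of_pos (by linarith : 0 < 1 - p)
  by_contra h
  push Not at h
  nlinarith

lemma aOne_pos {p : ℝ} (hp : 0 < p) (hp1 : p < 1) : 0 < aOne p := by
  have h2 : (2 : ℝ) ^ p < 2 ^ (1 : ℝ) := Real.rpow_lt_rpow_of_exponent_lt (by norm_num) hp1
  rw [Real.rpow_one] at h2
  exact mul_pos (abs_pos.2 (Gamma_neg_lt_zero hp hp1).ne) (by linarith)

lemma genCov_site_sub (a b a' b' : ℕ) : genCov φ₁ φ₂ (site a b - site a' b') =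
    φ₁ * Real.Gamma (-φ₂) * (((a : ℝ) - a') ^ 2 + ((b : ℝ) - b') ^ 2) ^ φ₂ := by
  rw [genCov, Real.rpow_mul (norm_nonneg _), Real.rpow_two, EuclideanSpace.real_norm_sq_eq,
    Fin.sum_univ_two]
  simp [site]

/-- The origin of `a₁`: the sixteen terms amount to `4K(0) - 8K(re₁) + 4K(re₁+re₂)` with `K(0) = 0`,
and `Γ(-φ₂) < 0` supplies the absolute value. -/
lemma lagCov_zero (hp : 0 < φ₂) (hp1 : φ₂ < 1) (r : ℕ) :
    lagCov φ₁ φ₂ r r (0, 0) = φ₁ * aOne φ₂ * ((r : ℝ) ^ 2) ^ φ₂ := by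
  have h := kernelForm_bilinContrast (φ₁ := φ₁) hp hp1 r r (0, 0) (0, 0)
  simp only [Nat.cast_zero, sub_self] at h
  rw [← h]
  simp only [kernelForm, bilinContrast, map_sub, map_add, Finsupp.linearCombination_single,
    one_smul, genCov_site_sub]
  rw [aOne, abs_of_neg (Gamma_neg_lt_zero hp hp1)]
  have h2 : ((r : ℝ) ^ 2 + (r : ℝ) ^ 2) ^ φ₂ = 2 ^ φ₂ * ((r : ℝ) ^ 2) ^ φ₂ := by
    rw [← two_mul, Real.mul_rpow (by norm_num) (sq_nonneg _)]
  simp [Real.zero_rpow hp.ne', h2]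
  ring

end Moments

section Counting

/-- The number of pairs in `{0,…,m-1} × {0,…,k-1}` with difference `j`. -/
noncomputable def diffCount (m k : ℕ) (j : ℤ) : ℝ :=
  ∑ a ∈ Finset.range m, ∑ b ∈ Finset.range k, if j = (a : ℤ) - b then 1 else 0

lemma diffCount_nonneg (m k : ℕ) (j : ℤ) : 0 ≤ diffCount m k j :=
  Finset.sum_nonneg fun _ _ => Finset.sum_nonneg fun _ _ => by split_ifs <;> norm_num

lemma diffCount_le (m k : ℕ) (j : ℤ) : diffCount m k j ≤ m := by
  have : ∀ a ∈ Finset.range m,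
      (∑ b ∈ Finset.range k, if j = (a : ℤ) - b then (1 : ℝ) else 0) ≤ 1 := by
    intro a _
    rw [Finset.sum_boole]
    have : ((Finset.range k).filter fun b : ℕ => j = (a : ℤ) - b).card ≤ 1 := by
      refine Finset.card_le_one.2 fun b hb b' hb' => ?_
      simp only [Finset.mem_filter] at hb hb'
      omega
    exact_mod_cast this
  refine (Finset.sum_le_sum this).trans_eq ?_
  simp

lemma le_diffCount (m k : ℕ) (j : ℤ) : ((min m k : ℕ) : ℝ) - |(j : ℝ)| ≤ diffCount m k j := by
  have h : ((Finset.range (min m k - j.natAbs)).card : ℕ) ≤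
      ((Finset.range m ×ˢ Finset.range k).filter fun z : ℕ × ℕ => j = (z.1 : ℤ) - z.2).card := by
    -- The pairs `(x + j⁺, x + j⁻)` all have difference `j`.
    refine Finset.card_le_card_of_injOn (fun x => (x + j.toNat, x + (-j).toNat)) ?_ ?_
    · intro x hx
      simp only [Finset.coe_range, mem_Iio, Finset.coe_filter, Finset.mem_product,
        Finset.mem_range, mem_ofPred_eq] at hx ⊢
      omega
    · intro x _ y _ hxy
      simp only [Prod.mk.injEq] at hxy
      omega
  rw [Finset.card_range] at h
  have h2 : diffCount m k j = (((Finset.range m ×ˢ Finset.range k).filter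
      fun z : ℕ × ℕ => j = (z.1 : ℤ) - z.2).card : ℝ) := by
    rw [diffCount, ← Finset.sum_product', Finset.sum_boole]
  rw [h2]
  have h3 : ((min m k : ℕ) : ℤ) - |j| ≤ ((min m k - j.natAbs : ℕ) : ℤ) := by
    rw [Int.abs_eq_natAbs]; omega
  have h4 : ((min m k : ℕ) : ℝ) - |(j : ℝ)| ≤ ((min m k - j.natAbs : ℕ) : ℝ) := by
    exact_mod_cast h3
  exact h4.trans (by exact_mod_cast h)

lemma sum_grid_eq_tsum (v : ℤ × ℤ → ℝ) (m k : ℕ) :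
    ∑ t ∈ grid m, ∑ t' ∈ grid k, v ((t.1 : ℤ) - t'.1, (t.2 : ℤ) - t'.2) =
      ∑' h : ℤ × ℤ, diffCount m k h.1 * diffCount m k h.2 * v h := by
  have h1 : ∀ z : ℤ × ℤ, HasSum (fun h : ℤ × ℤ =>
      (if h.1 = z.1 then (1 : ℝ) else 0) * (if h.2 = z.2 then 1 else 0) * v h) (v z) := by
    intro z
    convert hasSum_ite_eq z (v z) using 2 with h
    by_cases h1 : h.1 = z.1 <;> by_cases h2 : h.2 = z.2 <;> simp [Prod.ext_iff, h1, h2]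
    rw [show h = z from Prod.ext h1 h2]
  have h2 := hasSum_sum (s := grid m) fun t _ => hasSum_sum (s := grid k) fun t' _ =>
    h1 ((t.1 : ℤ) - t'.1, (t.2 : ℤ) - t'.2)
  rw [← h2.tsum_eq]
  refine tsum_congr fun h => ?_
  simp_rw [← Finset.sum_mul]
  congr 1
  rw [diffCount, diffCount, Finset.sum_mul_sum, grid, grid, Finset.sum_product]
  refine Finset.sum_congr rfl fun a _ => Finset.sum_congr rfl fun b _ => ?_
  rw [Finset.sum_product, Finset.sum_mul_sum]

lemma tendsto_natCast_sub_div (c : ℕ) :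
    Tendsto (fun n : ℕ => (n : ℝ) / ((n - c : ℕ) : ℝ)) atTop (𝓝 1) := by
  have h : Tendsto (fun n : ℕ => (1 - (c : ℝ) / n)⁻¹) atTop (𝓝 1) := by
    have := (tendsto_const_div_atTop_nhds_zero_nat (c : ℝ)).const_sub 1
    simpa using this.inv₀ (by norm_num)
  refine h.congr' ?_
  filter_upwards [eventually_gt_atTop c] with n hn
  have hn0 : (n : ℝ) ≠ 0 := by exact_mod_cast (Nat.zero_lt_of_lt hn).ne'
  rw [Nat.cast_sub hn.le]
  have : (n : ℝ) - c ≠ 0 := sub_ne_zero.2 (by exact_mod_cast hn.ne')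
  field_simp

lemma tendsto_diffCount_div (c d : ℕ) (j : ℤ) :
    Tendsto (fun n : ℕ => diffCount (n - c) (n - d) j / n) atTop (𝓝 1) := by
  have h1 : Tendsto (fun n : ℕ => 1 - ((c : ℝ) + d + |(j : ℝ)|) / n) atTop (𝓝 1) := by
    simpa using (tendsto_const_div_atTop_nhds_zero_nat ((c : ℝ) + d + |(j : ℝ)|)).const_sub 1
  refine tendsto_of_tendsto_of_tendsto_of_le_of_le' h1 tendsto_const_nhds ?_ ?_
  · filter_upwards [eventually_gt_atTop 0] with n hn
    have hn0 : (0 : ℝ) < n := by exact_mod_cast hn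
    rw [le_div_iff₀ hn0, sub_mul, div_mul_cancel₀ _ hn0.ne', one_mul]
    have h2 := le_diffCount (n - c) (n - d) j
    have h3 : (n : ℝ) ≤ ((min (n - c) (n - d) : ℕ) : ℝ) + c + d := by
      have : n ≤ min (n - c) (n - d) + c + d := by omega
      exact_mod_cast this
    linarith
  · filter_upwards [eventually_gt_atTop 0] with n hn
    have hn0 : (0 : ℝ) < n := by exact_mod_cast hn
    rw [div_le_one hn0]
    refine (diffCount_le _ _ _).trans ?_
    exact_mod_cast Nat.sub_le n c

/-- Averages over pairs of lattice points in two growing squares of an absolutely summable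
function of their difference. -/
lemma tendsto_sum_grid {v : ℤ × ℤ → ℝ} (hv : Summable fun h => |v h|) (c d : ℕ) :
    Tendsto (fun n : ℕ => (n : ℝ) ^ 2 / (((n - c : ℕ) : ℝ) ^ 2 * ((n - d : ℕ) : ℝ) ^ 2) *
      ∑ t ∈ grid (n - c), ∑ t' ∈ grid (n - d), v ((t.1 : ℤ) - t'.1, (t.2 : ℤ) - t'.2))
      atTop (𝓝 (∑' h, v h)) := by
  -- `w` is the normalised count in one coordinate; `w n h.1 * w n h.2` absorbs the whole prefactor.
  -- It tends to `1` and is eventually at most `2`, hence the dominating function `4|v|`.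
  set w : ℕ → ℤ → ℝ := fun n j => (n : ℝ) / ((n - c : ℕ) : ℝ) * ((n : ℝ) / ((n - d : ℕ) : ℝ)) *
    (diffCount (n - c) (n - d) j / n)
  have hpre := (tendsto_natCast_sub_div c).mul (tendsto_natCast_sub_div d)
  rw [one_mul] at hpre
  have hw : ∀ j, Tendsto (fun n => w n j) atTop (𝓝 1) := fun j => by
    simpa using hpre.mul (tendsto_diffCount_div c d j)
  have hle : ∀ᶠ n : ℕ in atTop, ∀ j, |w n j| ≤ 2 := by
    filter_upwards [hpre.eventually_le_const (by norm_num : (1 : ℝ) < 2),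
      eventually_gt_atTop 0] with n hn hn0 j
    have hn0' : (0 : ℝ) < n := by exact_mod_cast hn0
    have h1 : diffCount (n - c) (n - d) j / n ≤ 1 := by
      rw [div_le_one hn0']
      exact (diffCount_le _ _ _).trans (by exact_mod_cast Nat.sub_le n c)
    have h0 : 0 ≤ diffCount (n - c) (n - d) j / n := div_nonneg (diffCount_nonneg _ _ _) hn0'.le
    rw [abs_of_nonneg (mul_nonneg (by positivity) h0)]
    calc w n j ≤ 2 * 1 := mul_le_mul hn h1 h0 (by norm_num)
      _ = 2 := mul_one 2
  have key : Tendsto (fun n => ∑' h : ℤ × ℤ, w n h.1 * w n h.2 * v h) atTop (𝓝 (∑' h, v h)) := by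
    refine tendsto_tsum_of_dominated_convergence (bound := fun h => 4 * |v h|) (hv.mul_left 4)
      (fun h => ?_) ?_
    · simpa using ((hw h.1).mul (hw h.2)).mul_const (v h)
    · filter_upwards [hle] with n hn h
      rw [Real.norm_eq_abs, abs_mul, abs_mul]
      refine mul_le_mul_of_nonneg_right ?_ (abs_nonneg _)
      calc |w n h.1| * |w n h.2| ≤ 2 * 2 := mul_le_mul (hn _) (hn _) (abs_nonneg _) (by norm_num)
        _ = 4 := by norm_num
  refine key.congr' ?_
  filter_upwards [eventually_gt_atTop 0] with n hn
  have hn0 : (n : ℝ) ≠ 0 := by positivity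
  rw [sum_grid_eq_tsum, ← tsum_mul_left]
  refine tsum_congr fun h => ?_
  simp only [w, div_eq_mul_inv, mul_inv]
  field_simp

end Counting

end PowerLawIRF

/-! ### Limit of the characteristic function of `n(Q - q)`. -/

namespace PowerLawIRF

open Matrix WithLp

/-- The index set of all bilinear differences of step one and two observed on `Λ_n`. -/
abbrev GridIndex (n : ℕ) : Type := Σ j : Fin 2, {t // t ∈ grid (n - 2 * ((j : ℕ) + 1))}

/-- The family of all bilinear differences of step one and two observed on `Λ_n`. -/
noncomputable def gridContrast (n : ℕ) (i : GridIndex n) : Plane →₀ ℝ :=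
  bilinContrast ((i.1 : ℕ) + 1) i.2.1

/-- The weights of the quadratic form `∑ⱼ θⱼ n Q_{j+1}`. -/
noncomputable def gridWeight (θ : Fin 2 → ℝ) (n : ℕ) (i : GridIndex n) : ℝ :=
  θ i.1 * (n * ((grid (n - 2 * ((i.1 : ℕ) + 1))).card : ℝ)⁻¹)

lemma sum_gridIndex {n : ℕ} (f : Fin 2 → ℕ × ℕ → ℝ) :
    ∑ i : GridIndex n, f i.1 i.2.1 = ∑ j : Fin 2, ∑ t ∈ grid (n - 2 * ((j : ℕ) + 1)), f j t := by
  rw [Fintype.sum_sigma]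
  exact Finset.sum_congr rfl fun j _ => Finset.sum_coe_sort _ (f j)

lemma mass_gridContrast (n : ℕ) (i : GridIndex n) : mass (gridContrast n i) = 0 :=
  mass_bilinContrast _ _

section

variable {Ω : Type*} [MeasurableSpace Ω] {P : Measure Ω} {φ₁ φ₂ : ℝ} {X : Plane → Ω → ℝ}

lemma contrastCov_gridContrast (hp : 0 < φ₂) (hp1 : φ₂ < 1) {n : ℕ} (i i' : GridIndex n) :
    contrastCov φ₁ φ₂ (gridContrast n) i i' =
      lagCov φ₁ φ₂ ((i.1 : ℕ) + 1 : ℕ) ((i'.1 : ℕ) + 1 : ℕ)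
        ((i.2.1.1 : ℤ) - i'.2.1.1, (i.2.1.2 : ℤ) - i'.2.1.2) := by
  rw [contrastCov, Matrix.of_apply]
  exact kernelForm_bilinContrast hp hp1 _ _ _ _

/-- For a fixed index the differences of sites are distinct, so each row sum is at most an `ℓ¹` norm
over `ℤ²`. Summing over all pairs of steps makes the bound independent of the row and of `n`. -/
lemma sum_abs_contrastCov_le (φ₁ : ℝ) (hp : 0 < φ₂) (hp1 : φ₂ < 1) {n : ℕ} (i : GridIndex n) :
    ∑ i', |contrastCov φ₁ φ₂ (gridContrast n) i i'| ≤
      ∑ j : Fin 2, ∑ k : Fin 2, ∑' h, |lagCov φ₁ φ₂ ((j : ℕ) + 1 : ℕ) ((k : ℕ) + 1 : ℕ) h| := by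
  simp_rw [contrastCov_gridContrast hp hp1]
  rw [sum_gridIndex fun k t => |lagCov φ₁ φ₂ ((i.1 : ℕ) + 1 : ℕ) ((k : ℕ) + 1 : ℕ)
        ((i.2.1.1 : ℤ) - t.1, (i.2.1.2 : ℤ) - t.2)|]
  refine le_trans ?_ (Finset.single_le_sum (f := fun j : Fin 2 => ∑ k : Fin 2,
    ∑' h, |lagCov φ₁ φ₂ ((j : ℕ) + 1 : ℕ) ((k : ℕ) + 1 : ℕ) h|)
    (fun j _ => Finset.sum_nonneg fun k _ => tsum_nonneg fun h => abs_nonneg _)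
    (Finset.mem_univ i.1))
  refine Finset.sum_le_sum fun k _ => ?_
  have hinj : Function.Injective fun t : ℕ × ℕ =>
      ((i.2.1.1 : ℤ) - t.1, (i.2.1.2 : ℤ) - t.2) := by
    intro t t' h
    simp only [Prod.mk.injEq] at h
    ext <;> omega
  have hs := summable_abs_lagCov φ₁ hp hp1 ((i.1 : ℕ) + 1) ((k : ℕ) + 1)
  exact ((hs.comp_injective hinj).sum_le_tsum _ fun _ _ => abs_nonneg _).trans
    (tsum_comp_le_tsum_of_inj hs (fun _ => abs_nonneg _) hinj)

lemma summable_abs_lagCov_sq (φ₁ : ℝ) (hp : 0 < φ₂) (hp1 : φ₂ < 1) (r s : ℕ) :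
    Summable fun h => |lagCov φ₁ φ₂ r s h ^ 2| := by
  have hs := summable_abs_lagCov φ₁ hp hp1 r s
  refine (hs.mul_left (∑' h, |lagCov φ₁ φ₂ r s h|)).of_nonneg_of_le (fun _ => abs_nonneg _)
    fun h => ?_
  rw [abs_pow, sq]
  exact mul_le_mul_of_nonneg_right (hs.le_tsum h fun _ _ => abs_nonneg _) (abs_nonneg _)

lemma sum_gridWeight_contrastCov_sq (hp : 0 < φ₂) (hp1 : φ₂ < 1) (θ : Fin 2 → ℝ) (n : ℕ) :
    ∑ i, ∑ i', gridWeight θ n i * gridWeight θ n i' *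
        contrastCov φ₁ φ₂ (gridContrast n) i i' ^ 2 =
      ∑ j : Fin 2, ∑ k : Fin 2, θ j * θ k * ((n : ℝ) ^ 2 /
        (((n - 2 * ((j : ℕ) + 1) : ℕ) : ℝ) ^ 2 * ((n - 2 * ((k : ℕ) + 1) : ℕ) : ℝ) ^ 2) *
        ∑ t ∈ grid (n - 2 * ((j : ℕ) + 1)), ∑ t' ∈ grid (n - 2 * ((k : ℕ) + 1)),
          lagCov φ₁ φ₂ ((j : ℕ) + 1 : ℕ) ((k : ℕ) + 1 : ℕ)
            ((t.1 : ℤ) - t'.1, (t.2 : ℤ) - t'.2) ^ 2) := by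
  simp_rw [contrastCov_gridContrast hp hp1, gridWeight, card_grid]
  have h1 := fun i : GridIndex n => sum_gridIndex (n := n) fun k t' =>
    θ i.1 * (n * (((n - 2 * ((i.1 : ℕ) + 1) : ℕ) : ℝ) ^ 2)⁻¹) *
      (θ k * (n * (((n - 2 * ((k : ℕ) + 1) : ℕ) : ℝ) ^ 2)⁻¹)) *
      lagCov φ₁ φ₂ ((i.1 : ℕ) + 1 : ℕ) ((k : ℕ) + 1 : ℕ)
        ((i.2.1.1 : ℤ) - t'.1, (i.2.1.2 : ℤ) - t'.2) ^ 2
  refine (Finset.sum_congr rfl fun i _ => h1 i).trans ?_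
  rw [sum_gridIndex fun j t => ∑ k : Fin 2, ∑ t' ∈ grid (n - 2 * ((k : ℕ) + 1)),
    θ j * (n * (((n - 2 * ((j : ℕ) + 1) : ℕ) : ℝ) ^ 2)⁻¹) *
      (θ k * (n * (((n - 2 * ((k : ℕ) + 1) : ℕ) : ℝ) ^ 2)⁻¹)) *
      lagCov φ₁ φ₂ ((j : ℕ) + 1 : ℕ) ((k : ℕ) + 1 : ℕ)
        ((t.1 : ℤ) - t'.1, (t.2 : ℤ) - t'.2) ^ 2]
  refine Finset.sum_congr rfl fun j _ => ?_
  rw [Finset.sum_comm]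
  refine Finset.sum_congr rfl fun k _ => ?_
  rw [← mul_assoc (θ j * θ k), Finset.mul_sum]
  refine Finset.sum_congr rfl fun t _ => ?_
  rw [Finset.mul_sum]
  refine Finset.sum_congr rfl fun t' _ => ?_
  rw [div_eq_mul_inv, mul_inv]
  ring

/-- The quantity is half the variance of the quadratic form, hence the `1/2`: it is compared through
`e^(-∑ lam²)` with `e^(-θᵀΣθ/2)`. -/
lemma tendsto_sum_gridWeight (φ₁ : ℝ) (hp : 0 < φ₂) (hp1 : φ₂ < 1) (θ : Fin 2 → ℝ) :
    Tendsto (fun n => ∑ i, ∑ i', gridWeight θ n i * gridWeight θ n i' *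
        contrastCov φ₁ φ₂ (gridContrast n) i i' ^ 2) atTop
      (𝓝 (θ ⬝ᵥ sigmaMatrix φ₁ φ₂ *ᵥ θ / 2)) := by
  simp_rw [sum_gridWeight_contrastCov_sq hp hp1]
  have hlim : θ ⬝ᵥ sigmaMatrix φ₁ φ₂ *ᵥ θ / 2 = ∑ j : Fin 2, ∑ k : Fin 2, θ j * θ k *
      ∑' h, lagCov φ₁ φ₂ ((j : ℕ) + 1 : ℕ) ((k : ℕ) + 1 : ℕ) h ^ 2 := by
    simp only [dotProduct, mulVec, sigmaMatrix_apply φ₁ hp hp1, Finset.mul_sum, Finset.sum_div]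
    exact Finset.sum_congr rfl fun j _ => Finset.sum_congr rfl fun k _ => by ring
  rw [hlim]
  refine tendsto_finsetSum _ fun j _ => tendsto_finsetSum _ fun k _ => ?_
  exact (tendsto_sum_grid (summable_abs_lagCov_sq φ₁ hp hp1 _ _) _ _).const_mul _

/-- `n - 4` is the side of the smaller of the two grids, that of step `2`. -/
lemma abs_gridWeight_le (θ : Fin 2 → ℝ) {n : ℕ} (hn : 4 < n) (i : GridIndex n) :
    |gridWeight θ n i| ≤ (∑ j, |θ j|) * (n * (((n - 4 : ℕ) : ℝ) ^ 2)⁻¹) := by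
  have h4 : (0 : ℝ) < ((n - 4 : ℕ) : ℝ) := by
    have : 0 < n - 4 := by omega
    exact_mod_cast this
  have hle : ((n - 4 : ℕ) : ℝ) ≤ ((n - 2 * ((i.1 : ℕ) + 1) : ℕ) : ℝ) := by
    have := i.1.2
    exact_mod_cast (by omega : n - 4 ≤ n - 2 * ((i.1 : ℕ) + 1))
  rw [gridWeight, card_grid, abs_mul, abs_of_nonneg (by positivity :
    0 ≤ (n : ℝ) * (((n - 2 * ((i.1 : ℕ) + 1) : ℕ) : ℝ) ^ 2)⁻¹)]
  gcongr
  exact Finset.single_le_sum (f := fun j => |θ j|) (fun j _ => abs_nonneg _) (Finset.mem_univ i.1)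

lemma tendsto_mul_inv_sq : Tendsto (fun n : ℕ => (n : ℝ) * (((n - 4 : ℕ) : ℝ) ^ 2)⁻¹) atTop
    (𝓝 0) := by
  have h1 := tendsto_natCast_sub_div 4
  have h2 : Tendsto (fun n : ℕ => (((n - 4 : ℕ) : ℝ))⁻¹) atTop (𝓝 0) :=
    tendsto_inv_atTop_zero.comp (tendsto_natCast_atTop_atTop.comp (tendsto_sub_atTop_nat 4))
  have h3 := h1.mul h2
  rw [mul_zero] at h3
  refine h3.congr fun n => ?_
  rw [div_eq_mul_inv, sq, mul_inv, mul_assoc]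

lemma sum_gridWeight_mul (hX : IsPowerLawIRF P φ₁ φ₂ X) (hp : 0 < φ₂) (hp1 : φ₂ < 1)
    (θ : Fin 2 → ℝ) {n : ℕ} (hn : 4 < n) (ω : Ω) :
    ∑ i, gridWeight θ n i * (evalContrast X (gridContrast n i) ω ^ 2 -
      contrastCov φ₁ φ₂ (gridContrast n) i i) =
    ∑ j : Fin 2, θ j * (n * (quadVar X ((j : ℕ) + 1) n ω - meanSq P X ((j : ℕ) + 1))) := by
  simp_rw [contrastCov_gridContrast hp hp1, gridWeight, gridContrast, evalContrast_bilinContrast,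
    sub_self]
  rw [sum_gridIndex fun j t => θ j * (n * ((grid (n - 2 * ((j : ℕ) + 1))).card : ℝ)⁻¹) *
    (bilinDiff X ((j : ℕ) + 1) t ω ^ 2 - lagCov φ₁ φ₂ ((j : ℕ) + 1 : ℕ) ((j : ℕ) + 1 : ℕ) (0, 0))]
  refine Finset.sum_congr rfl fun j _ => ?_
  have hc : ((grid (n - 2 * ((j : ℕ) + 1))).card : ℝ) ≠ 0 := by
    rw [card_grid]
    have := j.2
    have : n - 2 * ((j : ℕ) + 1) ≠ 0 := by omega
    positivity
  rw [← Finset.mul_sum, Finset.sum_sub_distrib, Finset.sum_const, nsmul_eq_mul, hX.meanSq_eq hp hp1,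
    quadVar]
  field_simp

/-- Convergence of the characteristic function of `n (Q - q)`. -/
lemma IsPowerLawIRF.tendsto_charFun_quadVar [IsProbabilityMeasure P]
    (hX : IsPowerLawIRF P φ₁ φ₂ X) (hp : 0 < φ₂) (hp1 : φ₂ < 1) (θ : Fin 2 → ℝ) :
    Tendsto (fun n : ℕ => ∫ ω, Complex.exp (((∑ j : Fin 2, θ j * (n *
      (quadVar X ((j : ℕ) + 1) n ω - meanSq P X ((j : ℕ) + 1))) : ℝ) : ℂ) * Complex.I) ∂P) atTop
      (𝓝 (Complex.exp ((-(θ ⬝ᵥ sigmaMatrix φ₁ φ₂ *ᵥ θ / 2) : ℝ) : ℂ))) := by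
  have hV := tendsto_sum_gridWeight φ₁ hp hp1 θ
  set V : ℕ → ℝ := fun n => ∑ i, ∑ i', gridWeight θ n i * gridWeight θ n i' *
        contrastCov φ₁ φ₂ (gridContrast n) i i' ^ 2
  set v := θ ⬝ᵥ sigmaMatrix φ₁ φ₂ *ᵥ θ / 2
  have hexp : Tendsto (fun n => Complex.exp ((-(V n) : ℝ) : ℂ)) atTop
      (𝓝 (Complex.exp ((-v : ℝ) : ℂ))) :=
    ((Complex.continuous_exp.comp Complex.continuous_ofReal).tendsto _).comp hV.neg
  have hdiff : Tendsto (fun n : ℕ => (∫ ω, Complex.exp (((∑ j : Fin 2, θ j * (n *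
      (quadVar X ((j : ℕ) + 1) n ω - meanSq P X ((j : ℕ) + 1))) : ℝ) : ℂ) * Complex.I) ∂P) -
      Complex.exp ((-(V n) : ℝ) : ℂ)) atTop (𝓝 0) := by
    rw [Metric.tendsto_nhds]
    intro ε hε
    have hv1 : 0 < |v| + 1 := by positivity
    -- The tolerance is chosen so that, once `V n ≤ |v| + 1`, the total error is at most `ε/2`.
    obtain ⟨δ, hδ, hbound⟩ := quadForm_charFun_bound (ε := ε / (2 * (|v| + 1))) (by positivity)
    set R := ∑ j : Fin 2, ∑ k : Fin 2,
      ∑' h, |lagCov φ₁ φ₂ ((j : ℕ) + 1 : ℕ) ((k : ℕ) + 1 : ℕ) h|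
    have hA : Tendsto (fun n : ℕ => (∑ j, |θ j|) * (n * (((n - 4 : ℕ) : ℝ) ^ 2)⁻¹) * R) atTop
        (𝓝 0) := by
      simpa using (tendsto_mul_inv_sq.const_mul (∑ j, |θ j|)).mul_const R
    filter_upwards [hA.eventually_le_const hδ, eventually_gt_atTop 4,
      hV.eventually_le_const (by linarith [le_abs_self v] : v < |v| + 1)] with n hn1 hn hVn
    have key := hbound (contrastCov φ₁ φ₂ (gridContrast n))
      (hX.posSemidef_contrastCov (mass_gridContrast n)) (gridWeight θ n) _ R
      (abs_gridWeight_le θ hn) (sum_abs_contrastCov_le φ₁ hp hp1) hn1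
    rw [← hX.map_toLp_evalContrast (mass_gridContrast n),
      integral_map (hX.aemeasurable_toLp (mass_gridContrast n)) (by fun_prop)] at key
    simp_rw [sum_gridWeight_mul hX hp hp1 θ hn] at key
    rw [dist_zero_right]
    refine key.trans_lt ?_
    calc ε / (2 * (|v| + 1)) * V n ≤ ε / (2 * (|v| + 1)) * (|v| + 1) := by gcongr
      _ = ε / 2 := by field_simp
      _ < ε := by linarith
  simpa using hdiff.add hexp

end

end PowerLawIRF

/-! ### Tightness, the delta method and the limit theorem. -/

namespace PowerLawIRF

open Matrix WithLp

section

variable {Ω : Type*} [MeasurableSpace Ω] {P : Measure Ω} {φ₁ φ₂ : ℝ} {X : Plane → Ω → ℝ}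

lemma IsPowerLawIRF.aemeasurable_quadVar (hX : IsPowerLawIRF P φ₁ φ₂ X) (r n : ℕ) :
    AEMeasurable (quadVar X r n) P :=
  (hX.integrable_quadVar r n).aestronglyMeasurable.aemeasurable

/-- The normalised fluctuation `n (Q - q)`. -/
noncomputable def fluctuation (P : Measure Ω) (X : Plane → Ω → ℝ) (n : ℕ) (ω : Ω) : Plane :=
  (n : ℝ) • (!₂[quadVar X 1 n ω, quadVar X 2 n ω] - !₂[meanSq P X 1, meanSq P X 2])

lemma IsPowerLawIRF.aemeasurable_toLp_quadVar (hX : IsPowerLawIRF P φ₁ φ₂ X) (n : ℕ) :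
    AEMeasurable (fun ω => (!₂[quadVar X 1 n ω, quadVar X 2 n ω] : Plane)) P :=
  (MeasurableEquiv.toLp 2 (Fin 2 → ℝ)).measurable.comp_aemeasurable
    (aemeasurable_pi_lambda _ fun i => by
      fin_cases i
      exacts [hX.aemeasurable_quadVar 1 n, hX.aemeasurable_quadVar 2 n])

lemma IsPowerLawIRF.aemeasurable_fluctuation (hX : IsPowerLawIRF P φ₁ φ₂ X) (n : ℕ) :
    AEMeasurable (fluctuation P X n) P :=
  ((hX.aemeasurable_toLp_quadVar n).sub_const !₂[meanSq P X 1, meanSq P X 2]).const_smul (n : ℝ)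

/-- `θᵀΣθ/2` is a limit of sums of squared eigenvalues. -/
lemma IsPowerLawIRF.posSemidef_sigmaMatrix [IsProbabilityMeasure P] (hX : IsPowerLawIRF P φ₁ φ₂ X)
    (hp : 0 < φ₂) (hp1 : φ₂ < 1) : (sigmaMatrix φ₁ φ₂).PosSemidef := by
  refine Matrix.PosSemidef.of_dotProduct_mulVec_nonneg ?_ fun θ => ?_
  · ext j k
    simp only [conjTranspose_apply, sigmaMatrix, Matrix.of_apply, star_trivial]
    simp_rw [mul_comm (formSymbol _ k)]
  · have h : 0 ≤ θ ⬝ᵥ sigmaMatrix φ₁ φ₂ *ᵥ θ / 2 := by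
      refine ge_of_tendsto' (tendsto_sum_gridWeight φ₁ hp hp1 θ) fun n => ?_
      obtain ⟨lam, -, -, h3, -⟩ := exists_diagonalization
        (hX.posSemidef_contrastCov (mass_gridContrast n)) (gridWeight θ n)
      rw [← h3]
      positivity
    rw [star_trivial]
    linarith

lemma posSemidef_mul_mul_transpose {S : Matrix (Fin 2) (Fin 2) ℝ} (hS : S.PosSemidef)
    (B : Matrix (Fin 2) (Fin 2) ℝ) : (B * S * Bᵀ).PosSemidef := by
  have := hS.mul_mul_conjTranspose_same B
  rwa [conjTranspose_eq_transpose_of_trivial] at this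

/-- Pairing `B Y` with `v` is pairing `Y` with `Bᵀv`. The choice `B = 1` serves tightness, and the
Jacobian serves the delta method. -/
lemma IsPowerLawIRF.tendsto_charFun_fluctuation [IsProbabilityMeasure P]
    (hX : IsPowerLawIRF P φ₁ φ₂ X) (hp : 0 < φ₂) (hp1 : φ₂ < 1) (B : Matrix (Fin 2) (Fin 2) ℝ)
    (v : Plane) :
    Tendsto (fun n => charFun (P.map fun ω => toEuclideanCLM (𝕜 := ℝ) B (fluctuation P X n ω)) v)
      atTop (𝓝 (charFun (multivariateGaussian 0 (B * sigmaMatrix φ₁ φ₂ * Bᵀ)) v)) := by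
  have h := hX.tendsto_charFun_quadVar hp hp1 (Bᵀ *ᵥ v.ofLp)
  rw [charFun_multivariateGaussian
    (posSemidef_mul_mul_transpose (hX.posSemidef_sigmaMatrix hp hp1) B)]
  refine (h.congr fun n => ?_).trans_eq (congrArg 𝓝 ?_)
  · symm
    have hm : AEMeasurable (fun ω => toEuclideanCLM (𝕜 := ℝ) B (fluctuation P X n ω)) P :=
      (toEuclideanCLM (𝕜 := ℝ) B).measurable.comp_aemeasurable (hX.aemeasurable_fluctuation n)
    rw [charFun_apply, integral_map hm (by fun_prop)]
    refine integral_congr_ae (ae_of_all _ fun ω => ?_)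
    dsimp only
    congr 3
    rw [EuclideanSpace.inner_eq_star_dotProduct, star_trivial, ofLp_toEuclideanCLM,
      dotProduct_mulVec, ← mulVec_transpose, dotProduct]
    refine Finset.sum_congr rfl fun j _ => ?_
    fin_cases j <;> simp [fluctuation]
  · rw [inner_zero_right, ← mulVec_mulVec, ← mulVec_mulVec, dotProduct_mulVec v.ofLp B,
      ← mulVec_transpose, Complex.ofReal_zero, zero_mul, zero_sub]
    push_cast
    rfl

lemma IsPowerLawIRF.tendstoInDistribution_fluctuation [IsProbabilityMeasure P]
    (hX : IsPowerLawIRF P φ₁ φ₂ X) (hp : 0 < φ₂) (hp1 : φ₂ < 1)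
    (B : Matrix (Fin 2) (Fin 2) ℝ) :
    TendstoInDistribution (fun n ω => toEuclideanCLM (𝕜 := ℝ) B (fluctuation P X n ω)) atTop id
      (fun _ => P) (multivariateGaussian 0 (B * sigmaMatrix φ₁ φ₂ * Bᵀ)) where
  forall_aemeasurable n := (toEuclideanCLM (𝕜 := ℝ) B).measurable.comp_aemeasurable
    (hX.aemeasurable_fluctuation n)
  aemeasurable_limit := aemeasurable_id
  tendsto := by
    refine ProbabilityMeasure.tendsto_iff_tendsto_charFun.2 fun v => ?_
    simpa using hX.tendsto_charFun_fluctuation hp hp1 B v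

/-- The fluctuations are tight. -/
lemma IsPowerLawIRF.exists_measure_fluctuation_le [IsProbabilityMeasure P]
    (hX : IsPowerLawIRF P φ₁ φ₂ X) (hp : 0 < φ₂) (hp1 : φ₂ < 1) {ε : ENNReal} (hε : 0 < ε) :
    ∃ M : ℝ, ∀ n, P {ω | M < ‖fluctuation P X n ω‖} ≤ ε := by
  have hprob : ∀ n, IsProbabilityMeasure (P.map (fluctuation P X n)) := fun n =>
    Measure.isProbabilityMeasure_map (hX.aemeasurable_fluctuation n)
  -- Pointwise convergence of characteristic functions to a limit continuous at `0` makes the whole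
  -- sequence tight, so one `M` works for every `n`.
  have ht : IsTightMeasureSet (Set.range fun n => P.map (fluctuation P X n)) := by
    refine isTightMeasureSet_of_tendsto_charFun
      (f := charFun (multivariateGaussian 0 (1 * sigmaMatrix φ₁ φ₂ * 1ᵀ)))
      continuous_charFun.continuousAt fun v => ?_
    simpa using hX.tendsto_charFun_fluctuation hp hp1 1 v
  rw [isTightMeasureSet_iff_tendsto_measure_norm_gt] at ht
  obtain ⟨M, hM⟩ := (ht.eventually_le_const hε).exists
  refine ⟨M, fun n => le_trans ?_ hM⟩
  refine le_trans (le_of_eq ?_) (le_iSup₂ (f := fun μ (_ : μ ∈ Set.range fun n =>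
    P.map (fluctuation P X n)) => μ {x | M < ‖x‖}) _ (Set.mem_range_self n))
  rw [Measure.map_apply_of_aemeasurable (hX.aemeasurable_fluctuation n)
    (measurableSet_lt measurable_const measurable_norm)]
  rfl

end

section DeltaMethod

variable {Ω E F : Type*} [MeasurableSpace Ω] {P : Measure Ω} [NormedAddCommGroup E]
  [NormedSpace ℝ E] [NormedAddCommGroup F] {Y : ℕ → Ω → E} {y : E}

/-- Outside an event of probability at most `ε`, the scaled deviation is at most `M`, and there a
deterministic estimate applies. Both consistency and the delta remainder are of this kind. -/
lemma tendstoInMeasure_of_measure_le {f : ℕ → Ω → F} {g : Ω → F}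
    (hY : ∀ ε : ENNReal, 0 < ε → ∃ M : ℝ, ∀ n : ℕ, P {ω | M < ‖(n : ℝ) • (Y n ω - y)‖} ≤ ε)
    (hf : ∀ η > 0, ∀ M : ℝ, ∀ᶠ n : ℕ in atTop, ∀ ω, ‖(n : ℝ) • (Y n ω - y)‖ ≤ M →
      ‖f n ω - g ω‖ < η) : TendstoInMeasure P f atTop g := by
  rw [tendstoInMeasure_iff_norm]
  intro η hη
  rw [ENNReal.tendsto_atTop_zero]
  intro ε hε
  obtain ⟨M, hM⟩ := hY ε hε
  obtain ⟨N, hN⟩ := eventually_atTop.1 (hf η hη M)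
  refine ⟨N, fun n hn => (measure_mono fun ω hω => ?_).trans (hM n)⟩
  by_contra h
  exact absurd (hN n hn ω (not_lt.1 h)) (not_lt.2 hω)

lemma eventually_norm_sub_le {δ : ℝ} (hδ : 0 < δ) (M : ℝ) :
    ∀ᶠ n : ℕ in atTop, ∀ z : E, ‖(n : ℝ) • z‖ ≤ M → ‖z‖ < δ := by
  filter_upwards [tendsto_natCast_atTop_atTop.eventually_gt_atTop (M / δ),
    eventually_gt_atTop 0] with n hn hn0 z hz
  have hn0' : (0 : ℝ) < n := by exact_mod_cast hn0
  rw [norm_smul, Real.norm_of_nonneg hn0'.le] at hz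
  rw [div_lt_iff₀ hδ] at hn
  exact lt_of_mul_lt_mul_left (hz.trans_lt hn) hn0'.le

lemma tendstoInMeasure_comp_of_continuousAt {g : E → F} (hg : ContinuousAt g y)
    (hY : ∀ ε : ENNReal, 0 < ε → ∃ M : ℝ, ∀ n : ℕ, P {ω | M < ‖(n : ℝ) • (Y n ω - y)‖} ≤ ε) :
    TendstoInMeasure P (fun n ω => g (Y n ω)) atTop (fun _ => g y) := by
  refine tendstoInMeasure_of_measure_le hY fun η hη M => ?_
  obtain ⟨δ, hδ, h⟩ := Metric.continuousAt_iff.1 hg η hη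
  filter_upwards [eventually_norm_sub_le (E := E) hδ M] with n hn ω hω
  rw [← dist_eq_norm]
  exact h (by rw [dist_eq_norm]; exact hn _ hω)

/-- The remainder in the delta method. -/
lemma tendstoInMeasure_delta_remainder [NormedSpace ℝ F] {g : E → F} {L : E →L[ℝ] F} (hg : HasFDerivAt g L y)
    (hY : ∀ ε : ENNReal, 0 < ε → ∃ M : ℝ, ∀ n : ℕ, P {ω | M < ‖(n : ℝ) • (Y n ω - y)‖} ≤ ε) :
    TendstoInMeasure P (fun (n : ℕ) ω => (n : ℝ) • (g (Y n ω) - g y) - L ((n : ℝ) • (Y n ω - y)))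
      atTop 0 := by
  refine tendstoInMeasure_of_measure_le hY fun η hη M => ?_
  have hM : 0 < |M| + 1 := by positivity
  have h := (hasFDerivAt_iff_isLittleO.1 hg).def (c := η / (2 * (|M| + 1))) (by positivity)
  obtain ⟨δ, hδ, h⟩ := Metric.eventually_nhds_iff.1 h
  filter_upwards [eventually_norm_sub_le (E := E) hδ M] with n hn ω hω
  have h1 := h (y := Y n ω) (by rw [dist_eq_norm]; exact hn _ hω)
  rw [Pi.zero_apply, sub_zero, map_smul, ← smul_sub, norm_smul]
  rw [norm_smul] at hω
  calc ‖(n : ℝ)‖ * ‖g (Y n ω) - g y - L (Y n ω - y)‖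
      ≤ ‖(n : ℝ)‖ * (η / (2 * (|M| + 1)) * ‖Y n ω - y‖) := by gcongr
    _ = η / (2 * (|M| + 1)) * (‖(n : ℝ)‖ * ‖Y n ω - y‖) := by ring
    _ ≤ η / (2 * (|M| + 1)) * (|M| + 1) := by
        gcongr
        linarith [le_abs_self M]
    _ = η / 2 := by field_simp
    _ < η := by linarith

end DeltaMethod

section DeltaMap

/-- Measurability is needed on all of `ℝ`, since `φ̂₂` is not confined to `(0,1)`; `Γ` is a
pointwise limit of Euler's sequence. -/
lemma measurable_aOne : Measurable aOne := by
  have h : Measurable Real.Gamma := by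
    refine measurable_of_tendsto_metrizable (f := fun n s => Real.GammaSeq s n) (fun n => ?_)
      (tendsto_pi_nhds.2 fun s => Real.GammaSeq_tendsto_Gamma s)
    unfold Real.GammaSeq
    fun_prop
  have h2 : Measurable fun φ : ℝ => Real.Gamma (-φ) := h.comp measurable_neg
  unfold aOne
  fun_prop

lemma differentiableAt_aOne {p : ℝ} (hp : 0 < p) (hp1 : p < 1) : DifferentiableAt ℝ aOne p := by
  have hG : DifferentiableAt ℝ Real.Gamma (-p) := by
    refine Real.differentiableAt_Gamma fun m hm => ?_
    rcases Nat.eq_zero_or_pos m with rfl | hm0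
    · simp at hm
      linarith
    · have : (1 : ℝ) ≤ m := by exact_mod_cast hm0
      linarith
  have h1 : DifferentiableAt ℝ (fun φ : ℝ => Real.Gamma (-φ)) p :=
    hG.comp p differentiableAt_id.neg
  have h2 : DifferentiableAt ℝ (fun φ : ℝ => (2 : ℝ) ^ φ) p :=
    (Real.hasStrictDerivAt_const_rpow two_pos p).hasDerivAt.differentiableAt
  exact (h1.abs (Gamma_neg_lt_zero hp hp1).ne).mul ((h2.const_mul 4).const_sub 8)

lemma differentiableAt_deltaMap {y : Plane} (h0 : 0 < y 0) (h1 : 0 < y 1)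
    (hp : 0 < 1 / 2 * Real.logb 2 (y 1 / y 0)) (hp1 : 1 / 2 * Real.logb 2 (y 1 / y 0) < 1) :
    DifferentiableAt ℝ deltaMap y := by
  have c : ∀ i : Fin 2, DifferentiableAt ℝ (fun z : Plane => z i) y := fun i =>
    (EuclideanSpace.proj i : Plane →L[ℝ] ℝ).differentiableAt
  have hlog : DifferentiableAt ℝ (fun z : Plane => 1 / 2 * Real.logb 2 (z 1 / z 0)) y := by
    have hd : DifferentiableAt ℝ (fun z : Plane => z 1 / z 0) y := by
      simpa only [div_eq_mul_inv] using (c 1).fun_mul ((c 0).fun_inv h0.ne')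
    simpa only [Real.logb, div_eq_mul_inv] using
      ((hd.log (div_pos h1 h0).ne').mul_const (Real.log 2)⁻¹).const_mul (1 / 2)
  have ha : DifferentiableAt ℝ
      (fun z : Plane => aOne (1 / 2 * Real.logb 2 (z 1 / z 0))) y :=
    DifferentiableAt.comp (g := aOne) y (differentiableAt_aOne hp hp1) hlog
  rw [differentiableAt_euclidean]
  intro i
  fin_cases i
  · change DifferentiableAt ℝ (fun z : Plane => z 0 / aOne (1 / 2 * Real.logb 2 (z 1 / z 0))) y
    simpa only [div_eq_mul_inv] using (c 0).fun_mul (ha.fun_inv (aOne_pos hp hp1).ne')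
  · exact hlog

lemma fderiv_deltaMap_eq (y v : Plane) :
    fderiv ℝ deltaMap y v = toEuclideanCLM (𝕜 := ℝ) (jacobian y) v := by
  have hv : v = ∑ j, v j • EuclideanSpace.single j (1 : ℝ) := by
    ext i
    fin_cases i <;> simp
  ext i
  rw [ofLp_toEuclideanCLM]
  conv_lhs => rw [hv]
  simp [mulVec, dotProduct, jacobian, mul_comm]

lemma deltaMap_quadVar {Ω : Type*} (X : Plane → Ω → ℝ) (n : ℕ) (ω : Ω) :
    deltaMap !₂[quadVar X 1 n ω, quadVar X 2 n ω] = !₂[phiHatOne X n ω, phiHatTwo X n ω] := rfl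

end DeltaMap

section

variable {Ω : Type*} [MeasurableSpace Ω] {P : Measure Ω} {φ₁ φ₂ : ℝ} {X : Plane → Ω → ℝ}

lemma IsPowerLawIRF.meanSq_one (hX : IsPowerLawIRF P φ₁ φ₂ X) (hp : 0 < φ₂) (hp1 : φ₂ < 1) :
    meanSq P X 1 = φ₁ * aOne φ₂ := by
  rw [hX.meanSq_eq hp hp1, lagCov_zero hp hp1]
  simp

lemma IsPowerLawIRF.meanSq_two (hX : IsPowerLawIRF P φ₁ φ₂ X) (hp : 0 < φ₂) (hp1 : φ₂ < 1) :
    meanSq P X 2 = φ₁ * aOne φ₂ * 2 ^ (2 * φ₂) := by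
  rw [hX.meanSq_eq hp hp1, lagCov_zero hp hp1, Real.rpow_mul (by norm_num)]
  simp

lemma IsPowerLawIRF.half_logb_meanSq (hX : IsPowerLawIRF P φ₁ φ₂ X) (h₁ : 0 < φ₁) (hp : 0 < φ₂)
    (hp1 : φ₂ < 1) : 1 / 2 * Real.logb 2 (meanSq P X 2 / meanSq P X 1) = φ₂ := by
  have ha := aOne_pos hp hp1
  rw [hX.meanSq_one hp hp1, hX.meanSq_two hp hp1, mul_div_cancel_left₀ _ (by positivity),
    Real.logb_rpow two_pos (by norm_num)]
  ring

lemma IsPowerLawIRF.deltaMap_meanSq (hX : IsPowerLawIRF P φ₁ φ₂ X) (h₁ : 0 < φ₁) (hp : 0 < φ₂)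
    (hp1 : φ₂ < 1) : deltaMap !₂[meanSq P X 1, meanSq P X 2] = !₂[φ₁, φ₂] := by
  have h : deltaMap !₂[meanSq P X 1, meanSq P X 2] =
      !₂[meanSq P X 1 / aOne (1 / 2 * Real.logb 2 (meanSq P X 2 / meanSq P X 1)),
        1 / 2 * Real.logb 2 (meanSq P X 2 / meanSq P X 1)] := rfl
  rw [h, hX.half_logb_meanSq h₁ hp hp1, hX.meanSq_one hp hp1,
    mul_div_cancel_right₀ _ (aOne_pos hp hp1).ne']

lemma IsPowerLawIRF.differentiableAt_deltaMap_meanSq (hX : IsPowerLawIRF P φ₁ φ₂ X) (h₁ : 0 < φ₁)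
    (hp : 0 < φ₂) (hp1 : φ₂ < 1) :
    DifferentiableAt ℝ deltaMap !₂[meanSq P X 1, meanSq P X 2] := by
  have ha := aOne_pos hp hp1
  have hl := hX.half_logb_meanSq h₁ hp hp1
  refine differentiableAt_deltaMap ?_ ?_ (hp.trans_eq hl.symm) (hl.trans_lt hp1)
  · change 0 < meanSq P X 1
    rw [hX.meanSq_one hp hp1]
    positivity
  · change 0 < meanSq P X 2
    rw [hX.meanSq_two hp hp1]
    positivity

lemma IsPowerLawIRF.aemeasurable_estimator (hX : IsPowerLawIRF P φ₁ φ₂ X) (n : ℕ) :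
    AEMeasurable (fun ω => (!₂[phiHatOne X n ω, phiHatTwo X n ω] : Plane)) P := by
  have h2 : AEMeasurable (phiHatTwo X n) P :=
    ((Real.measurable_log.comp_aemeasurable ((hX.aemeasurable_quadVar 2 n).div
      (hX.aemeasurable_quadVar 1 n))).div_const (Real.log 2)).const_mul (1 / 2)
  have h1 : AEMeasurable (phiHatOne X n) P :=
    (hX.aemeasurable_quadVar 1 n).div (measurable_aOne.comp_aemeasurable h2)
  exact (MeasurableEquiv.toLp 2 (Fin 2 → ℝ)).measurable.comp_aemeasurable
    (aemeasurable_pi_lambda _ fun i => by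
      fin_cases i
      exacts [h1, h2])

end

end PowerLawIRF

theorem mainTheorem1 {Ω : Type*} [MeasurableSpace Ω] (P : Measure Ω) [IsProbabilityMeasure P]
    (φ₁ φ₂ : ℝ) (hφ₁ : 0 < φ₁) (hφ₂ : 0 < φ₂) (hφ₂' : φ₂ < 1)
    (X : Plane → Ω → ℝ) (hX : IsPowerLawIRF P φ₁ φ₂ X) :
    -- the objects in the limit law are well defined
    (∀ r ∈ ({1, 2} : Set ℕ), ∀ n : ℕ, 2 * r < n →
      Integrable (quadVar X r n) P ∧ ∫ ω, quadVar X r n ω ∂P = meanSq P X r) ∧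
    DifferentiableAt ℝ deltaMap !₂[meanSq P X 1, meanSq P X 2] ∧
    (∀ᵐ l ∂torusMeasure, Summable fun m : ℤ × ℤ => specDensity φ₁ φ₂
      (l + !₂[2 * Real.pi * (m.1 : ℝ), 2 * Real.pi * (m.2 : ℝ)])) ∧
    MemLp (diffDensity φ₁ φ₂) 2 torusMeasure ∧
    (limitCov φ₁ φ₂ !₂[meanSq P X 1, meanSq P X 2]).PosSemidef ∧
    -- consistency
    TendstoInMeasure P
      (fun (n : ℕ) ω => (!₂[phiHatOne X n ω, phiHatTwo X n ω] : Plane)) atTop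
      (fun _ => !₂[φ₁, φ₂]) ∧
    -- joint asymptotic normality, with `N = n²`
    TendstoInDistribution
      (fun (n : ℕ) ω =>
        Real.sqrt ((n : ℝ) ^ 2) • (!₂[phiHatOne X n ω - φ₁, phiHatTwo X n ω - φ₂] : Plane))
      atTop id (fun _ => P)
      (multivariateGaussian 0 (limitCov φ₁ φ₂ !₂[meanSq P X 1, meanSq P X 2])) := by
  have hdiff := hX.differentiableAt_deltaMap_meanSq hφ₁ hφ₂ hφ₂'
  have htight : ∀ ε : ENNReal, 0 < ε → ∃ M : ℝ, ∀ n : ℕ, P {ω | M < ‖(n : ℝ) •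
      (!₂[quadVar X 1 n ω, quadVar X 2 n ω] - !₂[meanSq P X 1, meanSq P X 2] : Plane)‖} ≤ ε :=
    fun ε hε => hX.exists_measure_fluctuation_le hφ₂ hφ₂' hε
  refine ⟨fun r _ n hn => ⟨hX.integrable_quadVar r n, hX.integral_quadVar hφ₂ hφ₂' hn⟩, hdiff,
    ae_summable_specDensity φ₁ hφ₂ hφ₂', memLp_diffDensity hφ₁.le hφ₂ hφ₂',
    posSemidef_mul_mul_transpose (hX.posSemidef_sigmaMatrix hφ₂ hφ₂') _, ?_, ?_⟩
  · have h := tendstoInMeasure_comp_of_continuousAt hdiff.continuousAt htight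
    simp_rw [deltaMap_quadVar, hX.deltaMap_meanSq hφ₁ hφ₂ hφ₂'] at h
    exact h
  -- As `√(n²) = n` and `h(q) = (φ₁, φ₂)`, the scaled error is `n(h(Q) - h(q))`.
  · have hEq : (fun (n : ℕ) ω => Real.sqrt ((n : ℝ) ^ 2) •
        (!₂[phiHatOne X n ω - φ₁, phiHatTwo X n ω - φ₂] : Plane)) =
        fun (n : ℕ) ω => (n : ℝ) • (deltaMap !₂[quadVar X 1 n ω, quadVar X 2 n ω] -
          deltaMap !₂[meanSq P X 1, meanSq P X 2]) := by
      ext n ω i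
      rw [deltaMap_quadVar, hX.deltaMap_meanSq hφ₁ hφ₂ hφ₂', Real.sqrt_sq n.cast_nonneg]
      fin_cases i <;> simp
    rw [hEq]
    have hrem := tendstoInMeasure_delta_remainder hdiff.hasFDerivAt htight
    simp_rw [fderiv_deltaMap_eq] at hrem
    -- Slutsky: the scaled error differs from `J n(Q - q)` by a remainder vanishing in probability.
    refine tendstoInDistribution_of_tendstoInMeasure_sub _ _
      (hX.tendstoInDistribution_fluctuation hφ₂ hφ₂'
        (jacobian !₂[meanSq P X 1, meanSq P X 2])) hrem fun n => ?_
    refine AEMeasurable.const_smul (AEMeasurable.sub_const ?_ _) (n : ℝ)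
    exact hX.aemeasurable_estimator n
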